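/- A partition $\pi$ is a finite multiset of positive integers (its parts); $|\pi|$ is the sum of its parts, $n(\pi)$ is the number of its parts and $n_o(\pi)$ is the number of its odd parts, both counted with multiplicity. The empty partition is allowed, and its largest part is taken to be $0$. For $n\ge 0$ let $D_{\le n}$ be the set of partitions into distinct parts each of which is at most $n$, let $D_n$ be the set of partitions into exactly $n$ distinct parts, and let $DE$ be the set of partitions in which no even part is repeated (odd parts may repeat). For partitions $\pi_1,\pi_2$ put $\gamma(\pi_1,\pi_2)=\pi_2'+n(\pi_1)$, where $\pi_2'$ is the largest part of $\pi_2$. Then all the sums below converge as formal power series in $q$ (with respect to coefficientwise convergence), and $$\sum_{n\ge0}\;\sum_{(\pi_1,\pi_2)\in D_{\le n}\times D_{n}}\left(\gamma(\pi_1,\pi_2)+\frac{1-(-1)^{\gamma(\pi_1,\pi_2)}}{2}\right)q^{|\pi_1|+|\pi_2|}=2\sum_{\pi\in DE}n_o(\pi)\,q^{|\pi|}.$$ -/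

import Mathlib

open scoped PowerSeries.WithPiTopology

/-- Integer partitions of arbitrary size: a natural number together with a partition of it. -/
abbrev IntPartition : Type := Σ m : ℕ, Nat.Partition m

namespace IntPartition

/-- The number `|π|` that `π` partitions. -/
def size (π : IntPartition) : ℕ := π.1

/-- The multiset of (positive) parts of `π`. -/
def parts (π : IntPartition) : Multiset ℕ := π.2.parts

/-- The number `n(π)` of parts, counted with multiplicity. -/
def numParts (π : IntPartition) : ℕ := Multiset.card π.parts

/-- The largest part of `π`, which is `0` for the empty partition. -/
def largestPart (π : IntPartition) : ℕ := π.parts.sup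

/-- The number `n_o(π)` of odd parts, counted with multiplicity. -/
def numOddParts (π : IntPartition) : ℕ := Multiset.countP (fun i => Odd i) π.parts

/-- The set `D_{≤ n}` of partitions into distinct parts, each at most `n`. -/
def distinctLe (n : ℕ) : Set IntPartition :=
  {π | π.parts.Nodup ∧ ∀ i ∈ π.parts, i ≤ n}

/-- The set `D_n` of partitions into exactly `n` distinct parts. -/
def distinctCard (n : ℕ) : Set IntPartition :=
  {π | π.parts.Nodup ∧ π.numParts = n}

/-- The set `DE` of partitions whose even parts do not repeat. -/
def distinctEven : Set IntPartition :=
  {π | ∀ i ∈ π.parts, Even i → π.parts.count i = 1}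

/-- `γ(π₁, π₂)`: the largest part of `π₂` plus the number of parts of `π₁`. -/
def gamma (π₁ π₂ : IntPartition) : ℕ := π₂.largestPart + π₁.numParts

/-- The term `(γ + (1 - (-1)^γ) / 2) q^(|π₁| + |π₂|)`, a formal power series in `q`. -/
noncomputable def pairTerm (π₁ π₂ : IntPartition) : PowerSeries ℚ :=
  PowerSeries.C ((gamma π₁ π₂ : ℚ) + (1 - (-1 : ℚ) ^ gamma π₁ π₂) / 2) *
    PowerSeries.X ^ (π₁.size + π₂.size)

/-- The term `n_o(π) q^|π|`, a formal power series in `q`. -/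
noncomputable def oddTerm (π : IntPartition) : PowerSeries ℚ :=
  PowerSeries.C (π.numOddParts : ℚ) * PowerSeries.X ^ π.size

end IntPartition

/-! Let G_m be the generating function of the pairs with γ = m (`gammaGF`), w(m) = m + (1 -
(-1)^m)/2, and L = ∑ X^(jk) over j ≥ 1 and odd k ≥ 1 (`oddDivisorGF`). The left side is ∑ w(m) G_m.
On the right, an odd part of π is marked by a value 2k+1 and an index j below its multiplicity;
removing j+1 copies of that value shows that ∑ n_o(π) X^|π| is L times the generating function of DE
(`tsum_oddTerm`). Lebesgue's identity, with Euler's theorem on odd and distinct parts, identifies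
that generating function with ∑ G_m. It remains to prove ∑ w(m) G_m = 2 L ∑ G_m
(`tsum_weight_mul_gammaGF`).

For this, take the Laurent series in z, with coefficients Q_m (`quotCoeff`), F(z) = (∑_k z^(2k)
X^(k(k+1))) / ∏_{n≥1} (1 - z X^n)(1 + z⁻¹ X^n). Comparing F(z) with F(zX) gives a recurrence for Q_m
that is also satisfied by G_m + G_{m+1}, and F(-1/z) = z² F(z) gives Q_{-1} = 0, so (1+X) Q_m = Q_0
(G_m + G_{m+1}) for m ≥ 0. The logarithmic derivative of F at z = 1 is 2L - 1: the theta numerator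
contributes -1, the product 2L. Hence ∑ (m+1) Q_m = 2L ∑ Q_m. Folding both sums by m ↦ -2-m and
inserting the G_m turns the left one into a multiple of ∑ w(m) G_m and the right one into the same
multiple of 2L ∑ G_m.

Every rearrangement is licensed by `XNull`: for each N, only finitely many terms matter modulo X^N.
-/

namespace PowerSeries

/-! ### Sums of X-adically null families -/

/-- A family of power series that tends to zero `X`-adically along the cofinite filter. -/
def XNull {ι : Type*} (f : ι → ℚ⟦X⟧) : Prop :=
  ∀ N : ℕ, {i | ¬ (X : ℚ⟦X⟧) ^ N ∣ f i}.Finite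

theorem eq_zero_of_forall_X_pow_dvd {f : ℚ⟦X⟧} (h : ∀ N : ℕ, X ^ N ∣ f) : f = 0 := by
  ext d
  simpa using X_pow_dvd_iff.1 (h (d + 1)) d (Nat.lt_succ_self d)

theorem eq_of_forall_X_pow_dvd_sub {f g : ℚ⟦X⟧} (h : ∀ N : ℕ, X ^ N ∣ f - g) : f = g :=
  sub_eq_zero.1 (eq_zero_of_forall_X_pow_dvd h)

theorem X_pow_dvd_tsum {ι : Type*} {f : ι → ℚ⟦X⟧} {N : ℕ} (h : ∀ i, X ^ N ∣ f i) :
    X ^ N ∣ ∑' i, f i := by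
  by_cases hf : Summable f
  · rw [X_pow_dvd_iff]
    intro d hd
    rw [hf.map_tsum _ (WithPiTopology.continuous_coeff _ _)]
    simp [fun i => X_pow_dvd_iff.1 (h i) d hd]
  · simp [tsum_eq_zero_of_not_summable hf]

theorem two_ne_zero_rat : (2 : ℚ⟦X⟧) ≠ 0 := fun h => by
  have := congrArg constantCoeff h
  rw [map_ofNat, map_zero] at this
  exact two_ne_zero this

namespace XNull

variable {ι κ : Type*} {f g : ι → ℚ⟦X⟧}

theorem summable (hf : XNull f) : Summable f := by
  rw [WithPiTopology.summable_iff_summable_coeff]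
  intro d
  apply summable_of_hasFiniteSupport
  refine (hf (d + 1)).subset fun i hi hd => hi ?_
  exact X_pow_dvd_iff.1 hd d (Nat.lt_succ_self d)

theorem of_dvd (hf : XNull f) (h : ∀ i, f i ∣ g i) : XNull g := fun N =>
  (hf N).subset fun i hi hd => hi (hd.trans (h i))

theorem add (hf : XNull f) (hg : XNull g) : XNull fun i => f i + g i := fun N =>
  ((hf N).union (hg N)).subset fun i hi => by
    by_contra h
    simp only [Set.mem_union, Set.mem_ofPred_eq, not_or, not_not] at h
    exact hi (dvd_add h.1 h.2)

theorem comp_injective (hf : XNull f) {e : κ → ι} (he : Function.Injective e) :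
    XNull fun k => f (e k) := fun N =>
  (hf N).preimage he.injOn

theorem mul_left (hf : XNull f) (a : ι → ℚ⟦X⟧) : XNull fun i => a i * f i :=
  hf.of_dvd fun _ => Dvd.intro_left _ rfl

theorem mul_right (hf : XNull f) (a : ι → ℚ⟦X⟧) : XNull fun i => f i * a i :=
  hf.of_dvd fun _ => Dvd.intro _ rfl

theorem prod_mul (hf : XNull f) {g : κ → ℚ⟦X⟧} (hg : XNull g) :
    XNull fun p : ι × κ => f p.1 * g p.2 := fun N =>
  ((hf N).prod (hg N)).subset fun p hp => by
    constructor
    · exact fun h => hp (Dvd.dvd.mul_right h _)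
    · exact fun h => hp (Dvd.dvd.mul_left h _)

theorem tsum_mul_left (hf : XNull f) (a : ℚ⟦X⟧) : ∑' i, a * f i = a * ∑' i, f i :=
  hf.summable.tsum_mul_left a

theorem of_finite [Finite ι] (f : ι → ℚ⟦X⟧) : XNull f := fun _ => Set.toFinite _

theorem of_nat {f : ℕ → ℚ⟦X⟧} (h : ∀ n, X ^ n ∣ f n) : XNull f := fun N =>
  (Set.finite_lt_nat N).subset fun n hn => by
    by_contra hlt
    exact hn ((pow_dvd_pow X (not_lt.1 hlt)).trans (h n))

theorem tsum_mul_tsum (hf : XNull f) {g : κ → ℚ⟦X⟧} (hg : XNull g) :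
    (∑' i, f i) * ∑' k, g k = ∑' p : ι × κ, f p.1 * g p.2 :=
  hf.summable.tsum_mul_tsum hg.summable (hf.prod_mul hg).summable

theorem slice {f : ι × κ → ℚ⟦X⟧} (hf : XNull f) (i : ι) : XNull fun k => f (i, k) :=
  hf.comp_injective (Prod.mk_right_injective i)

theorem tsum_slice {f : ι × κ → ℚ⟦X⟧} (hf : XNull f) : XNull fun i => ∑' k, f (i, k) := fun N =>
  ((hf N).image Prod.fst).subset fun i hi => by
    by_contra h
    refine hi (X_pow_dvd_tsum fun k => ?_)
    by_contra hk
    exact h ⟨(i, k), hk, rfl⟩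

theorem tsum_prod {f : ι × κ → ℚ⟦X⟧} (hf : XNull f) :
    ∑' p, f p = ∑' i, ∑' k, f (i, k) :=
  hf.summable.tsum_prod' fun i => (hf.slice i).summable

theorem tsum_comm {f : ι × κ → ℚ⟦X⟧} (hf : XNull f) :
    ∑' i, ∑' k, f (i, k) = ∑' k, ∑' i, f (i, k) := by
  have h := hf.comp_injective (Equiv.prodComm κ ι).injective
  rw [← hf.tsum_prod, ← (Equiv.prodComm κ ι).tsum_eq, h.tsum_prod]
  rfl

/-- Grouping the terms of a sum by the value of a map. -/
theorem tsum_fiber [DecidableEq κ] (hf : XNull f) (a : ι → κ) :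
    ∑' i, f i = ∑' k, ∑' i, if a i = k then f i else 0 := by
  have hsum : ∀ i, (∑' k, if a i = k then f i else 0) = f i := fun i =>
    (tsum_eq_single (a i) fun k hk => if_neg hk.symm).trans (if_pos rfl)
  have h : XNull fun p : ι × κ => if a p.1 = p.2 then f p.1 else 0 := fun N =>
    ((hf N).image fun i => (i, a i)).subset fun p hp => by
      rcases p with ⟨i, k⟩
      by_cases hk : a i = k
      · subst hk
        exact ⟨i, by simpa using hp, rfl⟩
      · simp [hk] at hp
  rw [← h.tsum_comm]
  exact (tsum_congr hsum).symm

end XNull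

/-! ### Finite sets of positive integers, by size and by maximum -/

/-- The generating function of the `j`-element subsets of `{1, …, n}`, by the sum of the elements. -/
noncomputable def subsetGF : ℕ → ℕ → ℚ⟦X⟧
  | _, 0 => 1
  | 0, _ + 1 => 0
  | n + 1, j + 1 => subsetGF n (j + 1) + X ^ (n + 1) * subsetGF n j

@[simp] theorem subsetGF_zero_right (n : ℕ) : subsetGF n 0 = 1 := by cases n <;> rfl

@[simp] theorem subsetGF_zero_succ (j : ℕ) : subsetGF 0 (j + 1) = 0 := rfl

theorem subsetGF_succ_succ (n j : ℕ) :
    subsetGF (n + 1) (j + 1) = subsetGF n (j + 1) + X ^ (n + 1) * subsetGF n j := rfl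

/-- Lower every element by one; an element 1 becomes 0 and is dropped. -/
theorem subsetGF_succ_succ' (n j : ℕ) :
    subsetGF (n + 1) (j + 1) = X ^ (j + 1) * (subsetGF n (j + 1) + subsetGF n j) := by
  induction n generalizing j with
  | zero => cases j <;> simp [subsetGF_succ_succ]
  | succ n ih =>
    have h₁ := subsetGF_succ_succ (n + 1) j
    have h₂ := subsetGF_succ_succ n j
    cases j with
    | zero =>
      rw [subsetGF_zero_right] at *
      linear_combination h₁ + ih 0 - X * h₂ + X * subsetGF_zero_right n
    | succ j =>
      linear_combination h₁ + ih (j + 1) + X ^ (n + 2) * ih j - X ^ (j + 2) * h₂ -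
        X ^ (j + 2) * subsetGF_succ_succ n j

theorem subsetGF_eq_zero {n j : ℕ} (h : n < j) : subsetGF n j = 0 := by
  induction n generalizing j with
  | zero => obtain ⟨j, rfl⟩ := Nat.exists_eq_succ_of_ne_zero h.ne_bot; rfl
  | succ n ih =>
    obtain ⟨j, rfl⟩ := Nat.exists_eq_succ_of_ne_zero h.ne_bot
    rw [Nat.succ_eq_add_one, subsetGF_succ_succ, ih (by omega), ih (by omega)]
    simp

theorem X_pow_dvd_subsetGF (n j : ℕ) : X ^ j ∣ subsetGF n j := by
  cases j with
  | zero => simp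
  | succ j =>
    cases n with
    | zero => simp
    | succ n => rw [subsetGF_succ_succ']; exact dvd_mul_right _ _

theorem subsetGF_eq_sum (n j : ℕ) :
    subsetGF n j = ∑ S ∈ (Finset.Icc 1 n).powersetCard j, X ^ (∑ i ∈ S, i) := by
  induction n generalizing j with
  | zero =>
    cases j with
    | zero => simp
    | succ j =>
      rw [Finset.powersetCard_eq_empty.2 (by simp)]
      rfl
  | succ n ih =>
    cases j with
    | zero => simp
    | succ j =>
      have hn : n + 1 ∉ Finset.Icc 1 n := by simp
      rw [subsetGF_succ_succ, ih, ih, ← Finset.insert_Icc_right_eq_Icc_add_one (by omega),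
        Finset.powersetCard_succ_insert hn, Finset.sum_union, Finset.sum_image, Finset.mul_sum]
      · congr 1
        refine Finset.sum_congr rfl fun S hS => ?_
        rw [Finset.sum_insert, pow_add X (n + 1)]
        exact fun h => hn ((Finset.mem_powersetCard.1 hS).1 h)
      · intro S hS T hT h
        have hS' : n + 1 ∉ S := fun h => hn ((Finset.mem_powersetCard.1 hS).1 h)
        have hT' : n + 1 ∉ T := fun h => hn ((Finset.mem_powersetCard.1 hT).1 h)
        rw [← Finset.erase_insert hS', ← Finset.erase_insert hT', h]
      · rw [Finset.disjoint_left]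
        intro S hS hS'
        obtain ⟨T, -, rfl⟩ := Finset.mem_image.1 hS'
        exact hn ((Finset.mem_powersetCard.1 hS).1 (Finset.mem_insert_self _ _))

/-- The generating function of the `n`-element sets of positive integers with maximum `l`
(with `l = 0` for the empty set). -/
noncomputable def maxGF : ℕ → ℕ → ℚ⟦X⟧
  | 0, 0 => 1
  | 0, _ + 1 => 0
  | _ + 1, 0 => 0
  | n + 1, l + 1 => X ^ (l + 1) * subsetGF l n

@[simp] theorem maxGF_zero_zero : maxGF 0 0 = 1 := rfl
@[simp] theorem maxGF_zero_succ (l : ℕ) : maxGF 0 (l + 1) = 0 := rfl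
@[simp] theorem maxGF_succ_zero (n : ℕ) : maxGF (n + 1) 0 = 0 := rfl
theorem maxGF_succ_succ (n l : ℕ) : maxGF (n + 1) (l + 1) = X ^ (l + 1) * subsetGF l n := rfl

/-- Raising only the maximum from l to l+1 misses exactly the sets that also contain l; deleting l+1
from these leaves a set with maximum l. -/
theorem maxGF_succ_succ_sub (n l : ℕ) :
    maxGF (n + 1) (l + 1) - X * maxGF (n + 1) l = X ^ (l + 1) * maxGF n l := by
  cases l with
  | zero => cases n <;> simp [maxGF_succ_succ]
  | succ l =>
    cases n with
    | zero => simp [maxGF_succ_succ]; ring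
    | succ n => simp only [maxGF_succ_succ, subsetGF_succ_succ]; ring

theorem maxGF_succ_succ' (n l : ℕ) :
    maxGF (n + 1) (l + 1) = X ^ (n + 1) * (maxGF (n + 1) l + maxGF n l) := by
  cases l with
  | zero => cases n <;> simp [maxGF_succ_succ]
  | succ l =>
    cases n with
    | zero => simp [maxGF_succ_succ]; ring
    | succ n => simp only [maxGF_succ_succ, subsetGF_succ_succ']; ring

theorem maxGF_eq_zero {n l : ℕ} (h : l < n) : maxGF n l = 0 := by
  obtain ⟨n, rfl⟩ := Nat.exists_eq_succ_of_ne_zero h.ne_bot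
  cases l with
  | zero => rfl
  | succ l => rw [Nat.succ_eq_add_one, maxGF_succ_succ, subsetGF_eq_zero (by omega), mul_zero]

theorem X_pow_dvd_maxGF (n l : ℕ) : X ^ l ∣ maxGF n l := by
  cases l with
  | zero => simp
  | succ l =>
    cases n with
    | zero => simp
    | succ n => exact dvd_mul_right _ _

/-! ### Distribution of γ and its three-term recurrence -/

/-- The generating function of the pairs in `D_{≤ n} × D_n` with `γ = m`. -/
noncomputable def pairGF (n m : ℕ) : ℚ⟦X⟧ :=
  ∑ p ∈ Finset.HasAntidiagonal.antidiagonal m, subsetGF n p.1 * maxGF n p.2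

/-- The generating function of all pairs with `γ = m`. -/
noncomputable def gammaGF (m : ℕ) : ℚ⟦X⟧ := ∑ n ∈ Finset.range (m + 1), pairGF n m

theorem mk_pairGF (n : ℕ) : (mk (pairGF n) : ℚ⟦X⟧⟦X⟧) = mk (subsetGF n) * mk (maxGF n) := by
  ext1 m
  simp [coeff_mul, pairGF]

theorem mk_subsetGF_succ (n : ℕ) :
    (mk (subsetGF (n + 1)) : ℚ⟦X⟧⟦X⟧) = (1 + C X * X) * rescale X (mk (subsetGF n)) := by
  ext1 j
  cases j with
  | zero =>
    simp only [add_mul, one_mul, mul_assoc, map_add, coeff_C_mul, coeff_zero_X_mul, coeff_rescale,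
      coeff_mk]
    simp
  | succ j =>
    simp [add_mul, mul_assoc, coeff_succ_X_mul, subsetGF_succ_succ']
    ring

theorem mk_maxGF_succ (n : ℕ) :
    (mk (maxGF (n + 1)) : ℚ⟦X⟧⟦X⟧) * (1 - C X * X) = C X * X * rescale X (mk (maxGF n)) := by
  ext1 l
  cases l with
  | zero => simp [mul_sub, mul_assoc, mul_left_comm _ (C X), coeff_zero_X_mul]
  | succ l =>
    have h := maxGF_succ_succ_sub n l
    simp [mul_sub, mul_assoc, mul_left_comm _ (C X), coeff_succ_X_mul, coeff_succ_mul_X]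
    rw [h]; ring

/-- With z the outer variable, marking γ, the series is ∏_{i=1}^n z X^i (1 + z X^i)/(1 - z X^i); the
factor i = 1 is split off and the others come from z ↦ zX. -/
theorem mk_pairGF_succ (n : ℕ) :
    (mk (pairGF (n + 1)) : ℚ⟦X⟧⟦X⟧) * (1 - C X * X) =
      (1 + C X * X) * (C X * X) * rescale X (mk (pairGF n)) := by
  rw [mk_pairGF, mk_pairGF, mul_assoc, mk_maxGF_succ, mk_subsetGF_succ, map_mul]
  ring

theorem pairGF_zero_succ (m : ℕ) : pairGF 0 (m + 1) = 0 := by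
  refine Finset.sum_eq_zero fun p hp => ?_
  rcases p with ⟨_ | j, _ | l⟩ <;> simp at hp ⊢

theorem pairGF_succ_add_two (n m : ℕ) :
    pairGF (n + 1) (m + 2) =
      X * pairGF (n + 1) (m + 1) + X ^ (m + 2) * (pairGF n (m + 1) + pairGF n m) := by
  have h := congrArg (coeff (m + 2)) (mk_pairGF_succ n)
  simp only [mul_sub, add_mul, mul_one, one_mul, mul_assoc, mul_left_comm _ (C X), map_sub,
    map_add, coeff_C_mul, coeff_succ_mul_X, coeff_succ_X_mul, coeff_mk, coeff_rescale] at h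
  linear_combination h

theorem pairGF_eq_zero {n m : ℕ} (h : m < n) : pairGF n m = 0 := by
  refine Finset.sum_eq_zero fun p hp => ?_
  rw [Finset.HasAntidiagonal.mem_antidiagonal] at hp
  rw [maxGF_eq_zero (by omega), mul_zero]

theorem X_pow_dvd_pairGF (n m : ℕ) : X ^ m ∣ pairGF n m := by
  refine Finset.dvd_sum fun p hp => ?_
  rw [← Finset.HasAntidiagonal.mem_antidiagonal.1 hp, pow_add]
  exact mul_dvd_mul (X_pow_dvd_subsetGF _ _) (X_pow_dvd_maxGF _ _)

theorem gammaGF_eq_sum_range {m N : ℕ} (h : m < N) :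
    gammaGF m = ∑ n ∈ Finset.range N, pairGF n m := by
  refine Finset.sum_subset (Finset.range_subset_range.2 h) fun n _ hn => pairGF_eq_zero ?_
  simpa using hn

theorem gammaGF_zero : gammaGF 0 = 1 := by simp [gammaGF, pairGF]

theorem gammaGF_one : gammaGF 1 = X := by
  simp [gammaGF, pairGF, Finset.sum_range_succ, Finset.Nat.antidiagonal_succ, maxGF_succ_succ]

/-- Sum `pairGF_succ_add_two` over n; the term n = 0, absent from that recurrence, vanishes for
positive γ. -/
theorem gammaGF_add_two (m : ℕ) :
    gammaGF (m + 2) = (X + X ^ (m + 2)) * gammaGF (m + 1) + X ^ (m + 2) * gammaGF m := by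
  rw [gammaGF, Finset.sum_range_succ', pairGF_zero_succ, add_zero]
  simp_rw [pairGF_succ_add_two, Finset.sum_add_distrib, ← Finset.mul_sum, Finset.sum_add_distrib]
  rw [← gammaGF_eq_sum_range (by omega), ← gammaGF_eq_sum_range (by omega)]
  have h : gammaGF (m + 1) = ∑ n ∈ Finset.range (m + 2), pairGF (n + 1) (m + 1) := by
    rw [gammaGF_eq_sum_range (N := m + 3) (by omega), Finset.sum_range_succ', pairGF_zero_succ,
      add_zero]
  rw [← h]
  ring

theorem X_pow_dvd_gammaGF (m : ℕ) : X ^ m ∣ gammaGF m :=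
  Finset.dvd_sum fun _ _ => X_pow_dvd_pairGF _ _

/-! ### Euler coefficients, signs and theta terms -/

/-- The inverse of `(1 - X) (1 - X ^ 2) ⋯ (1 - X ^ n)`. -/
noncomputable def invPochhammer (n : ℕ) : ℚ⟦X⟧ := (∏ i ∈ Finset.range n, (1 - X ^ (i + 1)))⁻¹

@[simp] theorem invPochhammer_zero : invPochhammer 0 = 1 := by simp [invPochhammer]

theorem prod_mul_invPochhammer (n : ℕ) :
    (∏ i ∈ Finset.range n, (1 - X ^ (i + 1))) * invPochhammer n = 1 :=
  PowerSeries.mul_inv_cancel _ (by simp)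

theorem invPochhammer_succ_mul (n : ℕ) :
    invPochhammer (n + 1) * (1 - X ^ (n + 1)) = invPochhammer n := by
  have h₁ := prod_mul_invPochhammer (n + 1)
  have h₂ := prod_mul_invPochhammer n
  rw [Finset.prod_range_succ] at h₁
  linear_combination invPochhammer n * h₁ - invPochhammer (n + 1) * (1 - X ^ (n + 1)) * h₂

/-- The coefficient of `z ^ i` in `1 / ((1 - z X) (1 - z X ^ 2) ⋯)`. -/
noncomputable def partsGF (i : ℤ) : ℚ⟦X⟧ := if 0 ≤ i then X ^ i.toNat * invPochhammer i.toNat else 0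

theorem partsGF_of_neg {i : ℤ} (h : i < 0) : partsGF i = 0 := if_neg (not_le.2 h)

theorem X_pow_dvd_partsGF (i : ℤ) : X ^ i.toNat ∣ partsGF i := by
  unfold partsGF
  split_ifs <;> simp

/-- For i > 0, partitions into i parts either have all parts at least 2 or contain a part 1. In this
form the relation also holds for i ≤ 0, so sums over ℤ need no boundary terms. -/
theorem partsGF_eq (i : ℤ) : partsGF i = partsGF i * X ^ i.toNat + X * partsGF (i - 1) := by
  rcases lt_trichotomy i 0 with h | rfl | h
  · simp [partsGF_of_neg h, partsGF_of_neg (show i - 1 < 0 by omega)]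
  · simp [partsGF_of_neg (show (-1 : ℤ) < 0 by omega)]
  · obtain ⟨n, rfl⟩ : ∃ n : ℕ, i = n + 1 := ⟨(i - 1).toNat, by omega⟩
    have h₁ := invPochhammer_succ_mul n
    have e₁ : ((n : ℤ) + 1).toNat = n + 1 := by omega
    have e₂ : ((n : ℤ) + 1 - 1).toNat = n := by omega
    rw [partsGF, partsGF, if_pos (by omega), if_pos (by omega), e₁, e₂]
    linear_combination X ^ (n + 1) * h₁

theorem xNull_partsGF : XNull partsGF := fun N =>
  (Set.finite_Ico 0 (N : ℤ)).subset fun i hi => by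
    by_contra h
    apply hi
    rcases lt_or_ge i 0 with h₀ | h₀
    · simp [partsGF_of_neg h₀]
    · refine (pow_dvd_pow X ?_).trans (X_pow_dvd_partsGF i)
      rw [Set.mem_Ico] at h
      omega

/-- The sign `(-1) ^ i`, as a power series. -/
noncomputable def altSign (i : ℤ) : ℚ⟦X⟧ := ((i.negOnePow : ℤ) : ℚ⟦X⟧)

@[simp] theorem altSign_zero : altSign 0 = 1 := by simp [altSign]

theorem altSign_add (i j : ℤ) : altSign (i + j) = altSign i * altSign j := by
  simp [altSign, Int.negOnePow_add]

theorem altSign_add_one (i : ℤ) : altSign (i + 1) = -altSign i := by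
  simp [altSign, Int.negOnePow_succ]

theorem altSign_natCast (n : ℕ) : altSign n = (-1) ^ n := by
  induction n with
  | zero => simp
  | succ n ih => rw [Nat.cast_succ, altSign_add_one, ih, pow_succ, mul_neg_one]

theorem altSign_add_two_mul (i k : ℤ) : altSign (i + 2 * k) = altSign i := by
  simp [altSign, Int.negOnePow_add, Int.negOnePow_two_mul]

/-- The terms `X ^ (k (k + 1))` of a theta series. -/
noncomputable def thetaTerm (k : ℤ) : ℚ⟦X⟧ := X ^ (k * (k + 1)).toNat

theorem mul_add_one_nonneg (k : ℤ) : 0 ≤ k * (k + 1) := by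
  rcases lt_or_ge k 0 with h | h <;> nlinarith

theorem thetaTerm_neg_one_sub (k : ℤ) : thetaTerm (-1 - k) = thetaTerm k := by
  unfold thetaTerm
  congr 2
  ring

theorem xNull_thetaTerm : XNull thetaTerm := fun N =>
  (Set.finite_Icc (-(N : ℤ) - 1) N).subset fun k hk => by
    by_contra h
    refine hk (pow_dvd_pow X ?_)
    rw [Set.mem_Icc, not_and_or, not_le, not_le] at h
    zify
    rw [Int.toNat_of_nonneg (mul_add_one_nonneg k)]
    rcases h with h | h <;> nlinarith

theorem xNull_triple :
    XNull fun p : ℤ × ℤ × ℤ => thetaTerm p.1 * (partsGF p.2.1 * partsGF p.2.2) :=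
  xNull_thetaTerm.prod_mul (xNull_partsGF.prod_mul xNull_partsGF)

/-! ### The theta quotient: recurrence and reflection -/

/-- The terms of the coefficient of `z ^ m` in
`(∑ k, z ^ (2 k) X ^ (k (k + 1))) / ∏ n ≥ 1, (1 - z X ^ n) (1 + z⁻¹ X ^ n)`. -/
noncomputable def quotTerm (m : ℤ) (p : ℤ × ℤ) : ℚ⟦X⟧ :=
  altSign (p.2 + m) * (thetaTerm p.1 * (partsGF p.2 * partsGF (2 * p.1 + p.2 - m)))

/-- The coefficient of `z ^ m` in
`(∑ k, z ^ (2 k) X ^ (k (k + 1))) / ∏ n ≥ 1, (1 - z X ^ n) (1 + z⁻¹ X ^ n)`. -/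
noncomputable def quotCoeff (m : ℤ) : ℚ⟦X⟧ := ∑' p, quotTerm m p

/-- The change of variables `(m, (k, i)) ↦ (k, (i, 2 k + i - m))`. -/
def tripleEquiv : ℤ × ℤ × ℤ ≃ ℤ × ℤ × ℤ where
  toFun p := (p.2.1, p.2.2, 2 * p.2.1 + p.2.2 - p.1)
  invFun q := (2 * q.1 + q.2.1 - q.2.2, q.1, q.2.1)
  left_inv p := by simp
  right_inv q := by simp

theorem xNull_quotTerm_prod : XNull fun p : ℤ × ℤ × ℤ => quotTerm p.1 p.2 :=
  (xNull_triple.comp_injective tripleEquiv.injective).mul_left fun p => altSign (p.2.2 + p.1)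

theorem xNull_quotTerm (m : ℤ) : XNull (quotTerm m) := xNull_quotTerm_prod.slice m

theorem xNull_quotCoeff : XNull quotCoeff := xNull_quotTerm_prod.tsum_slice

theorem theta_shift_exponent {k i m : ℤ} (hi : 0 ≤ i) (hm : 0 ≤ m) (hj : 0 ≤ 2 * k + i - m) :
    (k * (k + 1)).toNat + i.toNat =
      ((k - 1) * (k - 1 + 1)).toNat + m.toNat + (2 * k + i - m).toNat := by
  have h₁ := mul_add_one_nonneg k
  have h₂ := mul_add_one_nonneg (k - 1)
  zify
  rw [Int.toNat_of_nonneg h₁, Int.toNat_of_nonneg h₂, Int.toNat_of_nonneg hi,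
    Int.toNat_of_nonneg hm, Int.toNat_of_nonneg hj]
  ring

/-- Termwise form of (1 - zX) F(z) = X² (z² + z) F(zX). -/
theorem quotTerm_rec {m : ℤ} (hm : 0 ≤ m) (k i : ℤ) :
    quotTerm m (k, i) = X * quotTerm (m - 1) (k, i - 1) + X ^ m.toNat * quotTerm (m - 2) (k - 1, i)
      + X ^ (m.toNat + 1) * quotTerm (m - 1) (k - 1, i) := by
  -- Passing from k to k-1 lowers the theta exponent by 2k = m + j - i, where j = 2k+i-m. This
  -- trades the factor X^i beside `partsGF i` for X^j beside `partsGF j`, so that `partsGF_eq`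
  -- applies once at i and once at j.
  have key : thetaTerm k * (partsGF i * X ^ i.toNat * partsGF (2 * k + i - m)) =
      X ^ m.toNat * thetaTerm (k - 1) *
        (partsGF i * (partsGF (2 * k + i - m) * X ^ (2 * k + i - m).toNat)) := by
    rcases lt_or_ge i 0 with hi | hi
    · simp [partsGF_of_neg hi]
    rcases lt_or_ge (2 * k + i - m) 0 with hj | hj
    · simp [partsGF_of_neg hj]
    have h := congrArg (fun n => (X : ℚ⟦X⟧) ^ n) (theta_shift_exponent hi hm hj)
    simp only [pow_add] at h
    unfold thetaTerm
    linear_combination partsGF i * partsGF (2 * k + i - m) * h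
  have s₁ : altSign (i - 1 + (m - 1)) = altSign (i + m) := by
    rw [← altSign_add_two_mul (i + m) (-1)]; congr 1; ring
  have s₂ : altSign (i + (m - 2)) = altSign (i + m) := by
    rw [← altSign_add_two_mul (i + m) (-1)]; congr 1; ring
  have s₃ : altSign (i + (m - 1)) = -altSign (i + m) := by
    rw [← neg_eq_iff_eq_neg, ← altSign_add_one]; congr 1; ring
  have j₁ : 2 * k + (i - 1) - (m - 1) = 2 * k + i - m := by ring
  have j₂ : 2 * (k - 1) + i - (m - 2) = 2 * k + i - m := by ring
  have j₃ : 2 * (k - 1) + i - (m - 1) = 2 * k + i - m - 1 := by ring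
  simp only [quotTerm, s₁, s₂, s₃, j₁, j₂, j₃]
  linear_combination altSign (i + m) * (key + thetaTerm k * partsGF (2 * k + i - m) * partsGF_eq i
    - X ^ m.toNat * thetaTerm (k - 1) * partsGF i * partsGF_eq (2 * k + i - m))

theorem quotCoeff_rec {m : ℤ} (hm : 0 ≤ m) :
    quotCoeff m = (X + X ^ (m.toNat + 1)) * quotCoeff (m - 1)
      + X ^ m.toNat * quotCoeff (m - 2) := by
  let eL : ℤ × ℤ ≃ ℤ × ℤ := Equiv.prodCongr (Equiv.subRight 1) (Equiv.refl ℤ)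
  let eR : ℤ × ℤ ≃ ℤ × ℤ := Equiv.prodCongr (Equiv.refl ℤ) (Equiv.subRight 1)
  have h₁ := (xNull_quotTerm (m - 1)).comp_injective eR.injective
  have h₂ := (xNull_quotTerm (m - 2)).comp_injective eL.injective
  have h₃ := (xNull_quotTerm (m - 1)).comp_injective eL.injective
  have h₁' := h₁.summable.mul_left X
  have h₂' := h₂.summable.mul_left (X ^ m.toNat)
  have h₃' := h₃.summable.mul_left (X ^ (m.toNat + 1))
  have h : quotTerm m = fun p => X * quotTerm (m - 1) (eR p) + X ^ m.toNat * quotTerm (m - 2) (eL p)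
      + X ^ (m.toNat + 1) * quotTerm (m - 1) (eL p) := by
    funext ⟨k, i⟩
    exact quotTerm_rec hm k i
  rw [quotCoeff, h, (h₁'.add h₂').tsum_add h₃', h₁'.tsum_add h₂', h₁.tsum_mul_left,
    h₂.tsum_mul_left, h₃.tsum_mul_left, eR.tsum_eq, eL.tsum_eq, eL.tsum_eq]
  simp only [quotCoeff]
  ring

/-- This is F(-1/z) = z² F(z): replace k by -1-k and exchange the indices i and j = 2k+i-m of the
two products. -/
theorem quotCoeff_reflect (m : ℤ) : quotCoeff (-2 - m) = altSign m * quotCoeff m := by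
  let e : ℤ × ℤ ≃ ℤ × ℤ :=
    { toFun := fun p => (-1 - p.1, 2 * p.1 + p.2 - m)
      invFun := fun p => (-1 - p.1, 2 * p.1 + p.2 + 2 + m)
      left_inv := fun p => by ext <;> dsimp only <;> ring
      right_inv := fun p => by ext <;> dsimp only <;> ring }
  rw [quotCoeff, quotCoeff, ← (xNull_quotTerm m).tsum_mul_left, ← e.tsum_eq]
  refine tsum_congr fun p => ?_
  have s : altSign (2 * p.1 + p.2 - m + (-2 - m)) = altSign m * altSign (p.2 + m) := by
    rw [← altSign_add, ← altSign_add_two_mul (m + (p.2 + m)) (p.1 - 1 - 2 * m)]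
    congr 1; ring
  have j : 2 * (-1 - p.1) + (2 * p.1 + p.2 - m) - (-2 - m) = p.2 := by ring
  simp only [quotTerm, e, Equiv.coe_fn_mk, s, j, thetaTerm_neg_one_sub]
  ring

/-- -1 is the fixed point of m ↦ -2-m, and its sign is -1. -/
theorem quotCoeff_neg_one : quotCoeff (-1) = 0 := by
  have h := quotCoeff_reflect (-1)
  have s : altSign (-1) = -1 := by
    have := altSign_add_one (-1)
    rw [neg_add_cancel, altSign_zero] at this
    rw [this, neg_neg]
  rw [s, show (-2 - -1 : ℤ) = -1 by norm_num] at h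
  have h2 : (2 : ℚ⟦X⟧) * quotCoeff (-1) = 0 := by linear_combination h
  exact (mul_eq_zero.1 h2).resolve_left two_ne_zero_rat

/-- Both sides obey the recurrence of `quotCoeff_rec`, and 1 + X is G_0 + G_1. Two consecutive
indices are carried because the recurrence has order two; it starts from `quotCoeff_neg_one`. -/
theorem one_add_X_mul_quotCoeff (n : ℕ) :
    (1 + X) * quotCoeff n = quotCoeff 0 * (gammaGF n + gammaGF (n + 1)) ∧
    (1 + X) * quotCoeff (n + 1) = quotCoeff 0 * (gammaGF (n + 1) + gammaGF (n + 2)) := by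
  induction n with
  | zero =>
    have h := quotCoeff_rec (m := 1) (by norm_num)
    rw [sub_self, show (1 - 2 : ℤ) = -1 by norm_num, quotCoeff_neg_one] at h
    constructor
    · simp only [Nat.cast_zero, gammaGF_zero, zero_add, gammaGF_one]
      ring
    · simp only [Nat.cast_zero, zero_add, gammaGF_add_two 0, gammaGF_zero, gammaGF_one]
      rw [h]
      simp
      ring
  | succ n ih =>
    refine ⟨by exact_mod_cast ih.2, ?_⟩
    have h := quotCoeff_rec (m := n + 2) (by omega)
    rw [show (n + 2 - 1 : ℤ) = n + 1 by ring, show (n + 2 - 2 : ℤ) = n by ring,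
      show ((n : ℤ) + 2).toNat = n + 2 by omega] at h
    rw [show ((n + 1 : ℕ) : ℤ) + 1 = n + 2 by push_cast; ring, h]
    linear_combination (X + X ^ (n + 3)) * ih.2 + X ^ (n + 2) * ih.1
      - quotCoeff 0 * (gammaGF_add_two n) - quotCoeff 0 * (gammaGF_add_two (n + 1))

/-! ### Logarithmic derivative of the product at z = 1 -/

/-- The value at `z = X ^ n` of `∑ i, w i z ^ i X ^ i / ((1 - X) ⋯ (1 - X ^ i))`. -/
noncomputable def weightedSum (w : ℤ → ℚ⟦X⟧) (n : ℕ) : ℚ⟦X⟧ :=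
  ∑' i, w i * (partsGF i * X ^ (n * i.toNat))

theorem xNull_weightedSum (w : ℤ → ℚ⟦X⟧) (n : ℕ) :
    XNull fun i => w i * (partsGF i * X ^ (n * i.toNat)) :=
  (xNull_partsGF.mul_right _).mul_left w

theorem weightedSum_zero (w : ℤ → ℚ⟦X⟧) : weightedSum w 0 = ∑' i, w i * partsGF i := by
  simp [weightedSum]

/-- Apply `partsGF_eq` in the form X^i p_i = p_i - X p_{i-1} to each term, then shift the index of
the second sum. -/
theorem weightedSum_succ (w : ℤ → ℚ⟦X⟧) (n : ℕ) :
    weightedSum w (n + 1) =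
      weightedSum w n - X ^ (n + 1) * weightedSum (fun i => w (i + 1)) n := by
  have h₁ := xNull_weightedSum w n
  have h₂ := xNull_weightedSum (fun i => w (i + 1)) n
  have h₂' := h₂.comp_injective (Equiv.subRight (1 : ℤ)).injective
  simp only [Equiv.subRight_apply] at h₂'
  have hterm : ∀ i : ℤ, w i * (partsGF i * X ^ ((n + 1) * i.toNat)) =
      w i * (partsGF i * X ^ (n * i.toNat)) -
      X ^ (n + 1) * (w (i - 1 + 1) * (partsGF (i - 1) * X ^ (n * (i - 1).toNat))) := by
    intro i
    rw [sub_add_cancel]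
    rcases le_or_gt i 0 with hi | hi
    · rw [partsGF_of_neg (show i - 1 < 0 by omega), Int.toNat_of_nonpos hi]
      simp
    · have e : i.toNat = (i - 1).toNat + 1 := by omega
      have h := partsGF_eq i
      rw [e] at h ⊢
      linear_combination (-w i * X ^ (n * ((i - 1).toNat + 1))) * h
  rw [weightedSum, tsum_congr hterm, h₁.summable.tsum_sub (h₂'.mul_left fun _ => _).summable,
    h₂'.tsum_mul_left]
  congr 2
  exact (Equiv.subRight (1 : ℤ)).tsum_eq
    (fun i => w (i + 1) * (partsGF i * X ^ (n * i.toNat)))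

theorem constantCoeff_weightedSum (w : ℤ → ℚ⟦X⟧) (n : ℕ) :
    constantCoeff (weightedSum w n) = constantCoeff (w 0) := by
  have h := (xNull_weightedSum w n).summable.tsum_eq_add_tsum_ite 0
  have hd : X ^ 1 ∣ ∑' i : ℤ, if i = 0 then 0 else w i * (partsGF i * X ^ (n * i.toNat)) := by
    refine X_pow_dvd_tsum fun i => ?_
    split_ifs with hi
    · exact dvd_zero _
    rcases lt_or_ge i 0 with h₀ | h₀
    · simp [partsGF_of_neg h₀]
    · exact Dvd.dvd.mul_left (Dvd.dvd.mul_right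
        ((pow_dvd_pow X (by omega)).trans (X_pow_dvd_partsGF i)) _) _
  rw [pow_one, X_dvd_iff] at hd
  rw [weightedSum, h, map_add, hd]
  simp [partsGF]

theorem X_pow_dvd_weightedSum {w : ℤ → ℚ⟦X⟧} (hw : w 0 = 0) (n : ℕ) :
    X ^ n ∣ weightedSum w n := by
  refine X_pow_dvd_tsum fun i => ?_
  rcases lt_trichotomy i 0 with h | rfl | h
  · simp [partsGF_of_neg h]
  · simp [hw]
  · exact Dvd.dvd.mul_left (Dvd.dvd.mul_left
      (pow_dvd_pow X (Nat.le_mul_of_pos_right n (by omega))) _) _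

theorem weightedSum_neg (w : ℤ → ℚ⟦X⟧) (n : ℕ) :
    weightedSum (fun i => -w i) n = -weightedSum w n := by
  simp [weightedSum, tsum_neg]

theorem weightedSum_add (w v : ℤ → ℚ⟦X⟧) (n : ℕ) :
    weightedSum (fun i => w i + v i) n = weightedSum w n + weightedSum v n := by
  simp only [weightedSum, add_mul]
  exact (xNull_weightedSum w n).summable.tsum_add (xNull_weightedSum v n).summable

/-- The generating function `∑ X ^ (j k)` over `j ≥ 1` and odd `k`. -/
noncomputable def oddDivisorGF : ℚ⟦X⟧ := ∑' p : ℕ × ℕ, X ^ ((p.1 + 1) * (2 * p.2 + 1))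

theorem xNull_oddDivisor : XNull fun p : ℕ × ℕ => (X : ℚ⟦X⟧) ^ ((p.1 + 1) * (2 * p.2 + 1)) :=
  fun N => ((Set.finite_lt_nat N).prod (Set.finite_lt_nat N)).subset fun p hp => by
    constructor
    · by_contra h
      exact hp (pow_dvd_pow X (by simp at h; nlinarith))
    · by_contra h
      exact hp (pow_dvd_pow X (by simp at h; nlinarith))

theorem tsum_odd_multiples_mul (n : ℕ) :
    (∑' k : ℕ, (X : ℚ⟦X⟧) ^ ((n + 1) * (2 * k + 1))) * (1 - X ^ (n + 1) * X ^ (n + 1)) =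
      X ^ (n + 1) := by
  have h₀ : constantCoeff ((X : ℚ⟦X⟧) ^ (n + 1) * X ^ (n + 1)) = 0 := by simp
  have hs := WithPiTopology.summable_pow_of_constantCoeff_eq_zero h₀
  have h : ∀ k : ℕ, (X : ℚ⟦X⟧) ^ ((n + 1) * (2 * k + 1)) =
      X ^ (n + 1) * (X ^ (n + 1) * X ^ (n + 1)) ^ k := fun k => by ring
  rw [tsum_congr h, hs.tsum_mul_left, mul_assoc,
    WithPiTopology.tsum_pow_mul_one_sub_of_constantCoeff_eq_zero h₀, mul_one]

theorem X_pow_dvd_oddDivisorGF_sub (n : ℕ) :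
    X ^ n ∣ oddDivisorGF -
      ∑ i ∈ Finset.range n, ∑' k : ℕ, (X : ℚ⟦X⟧) ^ ((i + 1) * (2 * k + 1)) := by
  rw [oddDivisorGF, xNull_oddDivisor.tsum_prod,
    ← xNull_oddDivisor.tsum_slice.summable.sum_add_tsum_nat_add n, add_sub_cancel_left]
  refine X_pow_dvd_tsum fun i => X_pow_dvd_tsum fun k => pow_dvd_pow X ?_
  dsimp only
  nlinarith

/-- The logarithmic derivative at `z = 1` of `∏ n ≥ 1, 1 / ((1 - z X ^ n) (1 + z⁻¹ X ^ n))`. -/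
theorem weightedSum_wronskian :
    weightedSum (fun i => (i : ℚ⟦X⟧)) 0 * weightedSum altSign 0
      - weightedSum (fun _ => 1) 0 * weightedSum (fun i => i * altSign i) 0 =
    2 * oddDivisorGF * (weightedSum (fun _ => 1) 0 * weightedSum altSign 0) := by
  set U := weightedSum fun _ => 1 with hU
  set V := weightedSum altSign with hV
  set U' := weightedSum fun i => (i : ℚ⟦X⟧) with hU'
  set V' := weightedSum fun i => i * altSign i with hV'
  have rU : ∀ n, U (n + 1) = (1 - X ^ (n + 1)) * U n := fun n => by
    rw [hU, weightedSum_succ]; ring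
  have rV : ∀ n, V (n + 1) = (1 + X ^ (n + 1)) * V n := fun n => by
    rw [hV, weightedSum_succ]
    simp only [altSign_add_one, weightedSum_neg]; ring
  have rU' : ∀ n, U' (n + 1) = (1 - X ^ (n + 1)) * U' n - X ^ (n + 1) * U n := fun n => by
    rw [hU', weightedSum_succ]
    simp only [Int.cast_add, Int.cast_one, weightedSum_add]; ring
  have rV' : ∀ n, V' (n + 1) = (1 + X ^ (n + 1)) * V' n + X ^ (n + 1) * V n := fun n => by
    rw [hV', weightedSum_succ]
    simp only [altSign_add_one, Int.cast_add, Int.cast_one, mul_neg, add_mul, one_mul,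
      weightedSum_neg, weightedSum_add]
    ring
  -- Here U n = ∏_{i>n} 1/(1 - X^i) and V n = ∏_{i>n} 1/(1 + X^i). Each step n to n+1 removes
  -- X^(n+1)/(1 - X^(n+1)) + X^(n+1)/(1 + X^(n+1)) = 2 X^(n+1)/(1 - X^(2n+2)) from U'/U - V'/V; the
  -- identity is stated with denominators cleared.
  have tele : ∀ n, (U' 0 * V 0 - U 0 * V' 0) * (U n * V n) =
      U 0 * V 0 * (U' n * V n - U n * V' n) + 2 * (U 0 * V 0) * (U n * V n) *
        ∑ i ∈ Finset.range n, ∑' k : ℕ, X ^ ((i + 1) * (2 * k + 1)) := by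
    intro n
    induction n with
    | zero => simp; ring
    | succ n ih =>
      rw [Finset.sum_range_succ, rU, rV, rU', rV']
      have h := tsum_odd_multiples_mul n
      set d := ∑' k : ℕ, (X : ℚ⟦X⟧) ^ ((n + 1) * (2 * k + 1))
      linear_combination (1 - X ^ (n + 1) * X ^ (n + 1)) * ih
        - 2 * (U 0 * V 0) * (U n * V n) * h
  refine eq_of_forall_X_pow_dvd_sub fun n => ?_
  have hunit : IsUnit (U n * V n) := by
    rw [isUnit_iff_constantCoeff, map_mul, hU, hV, constantCoeff_weightedSum,
      constantCoeff_weightedSum]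
    simp
  -- The remainder of the telescoping vanishes in the limit, since the derivative weights kill the
  -- index 0.
  have h₁ : X ^ n ∣ U' n := X_pow_dvd_weightedSum (by simp) n
  have h₂ : X ^ n ∣ V' n := X_pow_dvd_weightedSum (by simp) n
  rw [← hunit.dvd_mul_right]
  have h₃ : (U' 0 * V 0 - U 0 * V' 0 - 2 * oddDivisorGF * (U 0 * V 0)) * (U n * V n) =
      U 0 * V 0 * (U' n * V n - U n * V' n) - 2 * (U 0 * V 0) * (U n * V n) * (oddDivisorGF -
        ∑ i ∈ Finset.range n, ∑' k : ℕ, X ^ ((i + 1) * (2 * k + 1))) := by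
    linear_combination tele n
  rw [h₃]
  exact dvd_sub (Dvd.dvd.mul_left (dvd_sub (h₁.mul_right _) (h₂.mul_left _)) _)
    (Dvd.dvd.mul_left (X_pow_dvd_oddDivisorGF_sub n) _)

/-! ### Values of F and of its derivative at z = 1 -/

/-- In the variables k, i, j with m = 2k+i-j the three factors of F decouple. -/
theorem tsum_mul_quotCoeff (a : ℤ → ℚ⟦X⟧) :
    ∑' m, a m * quotCoeff m = ∑' p : ℤ × ℤ × ℤ, a (2 * p.1 + p.2.1 - p.2.2) *
      (thetaTerm p.1 * (partsGF p.2.1 * (altSign p.2.2 * partsGF p.2.2))) := by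
  have h := xNull_quotTerm_prod.mul_left fun p => a p.1
  rw [← tripleEquiv.tsum_eq fun p : ℤ × ℤ × ℤ => a (2 * p.1 + p.2.1 - p.2.2) *
    (thetaTerm p.1 * (partsGF p.2.1 * (altSign p.2.2 * partsGF p.2.2)))]
  have h₁ : ∀ m, a m * quotCoeff m = ∑' p, a m * quotTerm m p := fun m =>
    ((xNull_quotTerm m).tsum_mul_left _).symm
  rw [tsum_congr h₁, ← h.tsum_prod]
  refine tsum_congr fun p => ?_
  have s : altSign (p.2.2 + p.1) = altSign (2 * p.2.1 + p.2.2 - p.1) := by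
    rw [← altSign_add_two_mul (2 * p.2.1 + p.2.2 - p.1) (p.1 - p.2.1)]
    congr 1; ring
  have m : 2 * p.2.1 + p.2.2 - (2 * p.2.1 + p.2.2 - p.1) = p.1 := by ring
  simp only [tripleEquiv, Equiv.coe_fn_mk, quotTerm, s, m]
  ring

/-- The substitution k ↦ -1-k fixes the theta terms and sends 2k to -2-2k. -/
theorem tsum_two_mul_thetaTerm : ∑' k : ℤ, 2 * (k : ℚ⟦X⟧) * thetaTerm k = -∑' k, thetaTerm k := by
  have h₁ := xNull_thetaTerm.mul_left fun k => 2 * (k : ℚ⟦X⟧)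
  have e := (Equiv.subLeft (-1 : ℤ)).tsum_eq fun k => 2 * (k : ℚ⟦X⟧) * thetaTerm k
  have h : ∀ k : ℤ, 2 * ((Equiv.subLeft (-1 : ℤ) k : ℤ) : ℚ⟦X⟧) * thetaTerm (Equiv.subLeft (-1) k) =
      -(2 * k * thetaTerm k + 2 * thetaTerm k) := fun k => by
    simp only [Equiv.subLeft_apply, thetaTerm_neg_one_sub]
    push_cast
    ring
  rw [tsum_congr h, tsum_neg, h₁.summable.tsum_add (xNull_thetaTerm.mul_left _).summable,
    xNull_thetaTerm.tsum_mul_left] at e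
  refine mul_left_cancel₀ two_ne_zero_rat ?_
  linear_combination -e

theorem tsum_quotCoeff : ∑' m, quotCoeff m =
    (∑' k, thetaTerm k) * (weightedSum (fun _ => 1) 0 * weightedSum altSign 0) := by
  have h := tsum_mul_quotCoeff fun _ => 1
  have hV := xNull_partsGF.mul_left altSign
  simp only [one_mul] at h
  rw [h, weightedSum_zero, weightedSum_zero]
  simp only [one_mul]
  rw [xNull_partsGF.tsum_mul_tsum hV, xNull_thetaTerm.tsum_mul_tsum (xNull_partsGF.prod_mul hV)]

/-- Product rule at z = 1: the weight m = 2k+i-j splits into a theta derivative and the two terms of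
`weightedSum_wronskian`. -/
theorem tsum_intCast_mul_quotCoeff :
    ∑' m : ℤ, (m : ℚ⟦X⟧) * quotCoeff m = (2 * oddDivisorGF - 1) * ∑' m, quotCoeff m := by
  have hV := xNull_partsGF.mul_left altSign
  have hV' := xNull_partsGF.mul_left fun i => i * altSign i
  have hU' := xNull_partsGF.mul_left fun i => (i : ℚ⟦X⟧)
  have hT' := xNull_thetaTerm.mul_left fun k => 2 * (k : ℚ⟦X⟧)
  have hsplit : ∀ p : ℤ × ℤ × ℤ, ((2 * p.1 + p.2.1 - p.2.2 : ℤ) : ℚ⟦X⟧) *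
      (thetaTerm p.1 * (partsGF p.2.1 * (altSign p.2.2 * partsGF p.2.2))) =
      2 * p.1 * thetaTerm p.1 * (partsGF p.2.1 * (altSign p.2.2 * partsGF p.2.2)) +
      thetaTerm p.1 * (p.2.1 * partsGF p.2.1 * (altSign p.2.2 * partsGF p.2.2)) -
      thetaTerm p.1 * (partsGF p.2.1 * (p.2.2 * altSign p.2.2 * partsGF p.2.2)) := fun p => by
    push_cast
    ring
  have n₁ := hT'.prod_mul (xNull_partsGF.prod_mul hV)
  have n₂ := xNull_thetaTerm.prod_mul (hU'.prod_mul hV)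
  have n₃ := xNull_thetaTerm.prod_mul (xNull_partsGF.prod_mul hV')
  rw [tsum_mul_quotCoeff, tsum_congr hsplit,
    (n₁.add n₂).summable.tsum_sub n₃.summable, n₁.summable.tsum_add n₂.summable,
    ← hT'.tsum_mul_tsum (xNull_partsGF.prod_mul hV),
    ← xNull_thetaTerm.tsum_mul_tsum (hU'.prod_mul hV),
    ← xNull_thetaTerm.tsum_mul_tsum (xNull_partsGF.prod_mul hV'),
    ← xNull_partsGF.tsum_mul_tsum hV, ← hU'.tsum_mul_tsum hV, ← xNull_partsGF.tsum_mul_tsum hV',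
    tsum_two_mul_thetaTerm, tsum_quotCoeff]
  have h := weightedSum_wronskian
  simp only [weightedSum_zero, one_mul] at h ⊢
  linear_combination (∑' k, thetaTerm k) * h

/-- The constant term is 2: only k = 0 and k = -1 give theta exponent 0. -/
theorem tsum_quotCoeff_ne_zero : ∑' m, quotCoeff m ≠ 0 := by
  intro h0
  have hΘ : constantCoeff (∑' k, thetaTerm k) = 2 := by
    have h₁ := xNull_thetaTerm.summable.tsum_eq_add_tsum_ite 0
    have hn : XNull fun k : ℤ => if k = 0 then 0 else thetaTerm k := fun N =>
      (xNull_thetaTerm N).subset fun k hk hd => hk (by dsimp only; split_ifs; exacts [dvd_zero _, hd])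
    have h₂ := hn.summable.tsum_eq_add_tsum_ite (-1)
    have hd : X ^ 1 ∣ ∑' k : ℤ, if k = -1 then 0 else if k = 0 then 0 else thetaTerm k := by
      refine X_pow_dvd_tsum fun k => ?_
      split_ifs with hk hk'
      · exact dvd_zero _
      · exact dvd_zero _
      · refine pow_dvd_pow X ?_
        zify
        rw [Int.toNat_of_nonneg (mul_add_one_nonneg k)]
        rcases lt_or_ge k 0 with h | h
        · nlinarith [show k ≤ -2 by omega]
        · nlinarith [show 1 ≤ k by omega]
    rw [pow_one, X_dvd_iff] at hd
    rw [h₁, h₂, map_add, map_add, hd]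
    norm_num [thetaTerm]
  have h := congrArg constantCoeff tsum_quotCoeff
  rw [h0, map_mul, map_mul, hΘ, constantCoeff_weightedSum, constantCoeff_weightedSum] at h
  simp at h

/-! ### Folding onto nonnegative indices -/

theorem tsum_mul_quotCoeff_nat (a : ℤ → ℚ⟦X⟧) : ∑' m, a m * quotCoeff m =
    ∑' n : ℕ, (a n + a (-2 - n) * altSign n) * quotCoeff n := by
  have h₁ : XNull fun n : ℕ => a n * quotCoeff n :=
    (xNull_quotCoeff.mul_left a).comp_injective (Nat.cast_injective (R := ℤ))
  have h₂ : XNull fun n : ℕ => a (-(n + 1)) * quotCoeff (-(n + 1)) :=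
    (xNull_quotCoeff.mul_left a).comp_injective
      (e := fun n : ℕ => -((n : ℤ) + 1)) fun m n h => by simpa using h
  have h₃ : XNull fun n : ℕ => a (-2 - n) * quotCoeff (-2 - n) :=
    (xNull_quotCoeff.mul_left a).comp_injective
      (e := fun n : ℕ => -2 - (n : ℤ)) fun m n h => by simpa using h
  rw [tsum_of_nat_of_neg_add_one (f := fun m => a m * quotCoeff m) h₁.summable h₂.summable, h₂.summable.tsum_eq_zero_add]
  simp only [Nat.cast_zero, zero_add, quotCoeff_neg_one, mul_zero]
  have e : ∀ n : ℕ, -(((n + 1 : ℕ) : ℤ) + 1) = -2 - n := fun n => by push_cast; ring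
  simp only [e]
  rw [← h₁.summable.tsum_add h₃.summable]
  refine tsum_congr fun n => ?_
  rw [quotCoeff_reflect (n : ℤ)]
  ring

theorem xNull_gammaGF : XNull gammaGF := XNull.of_nat X_pow_dvd_gammaGF

/-- Summation by parts; `ha` removes the boundary term. -/
theorem tsum_mul_gammaGF_add_succ (a : ℕ → ℚ⟦X⟧) (ha : a 0 = 0) :
    ∑' n, a (n + 1) * (gammaGF n + gammaGF (n + 1)) = ∑' n, (a (n + 1) + a n) * gammaGF n := by
  have h₁ := xNull_gammaGF.mul_left fun n => a (n + 1)
  have h₂ := xNull_gammaGF.mul_left a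
  have h₃ := h₂.comp_injective (Nat.succ_injective)
  simp only [mul_add, add_mul]
  rw [h₁.summable.tsum_add h₃.summable, h₁.summable.tsum_add h₂.summable,
    h₂.summable.tsum_eq_zero_add, ha, zero_mul, zero_add]

theorem one_add_X_mul_tsum (a : ℤ → ℚ⟦X⟧) (c : ℕ → ℚ⟦X⟧) (hc : c 0 = 0)
    (hac : ∀ n : ℕ, a n + a (-2 - n) * altSign n = c (n + 1)) :
    (1 + X) * ∑' m, a m * quotCoeff m = quotCoeff 0 * ∑' n, (c (n + 1) + c n) * gammaGF n := by
  have h₁ := xNull_quotCoeff.comp_injective (Nat.cast_injective (R := ℤ))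
  have h₂ := xNull_gammaGF.add (xNull_gammaGF.comp_injective Nat.succ_injective)
  rw [tsum_mul_quotCoeff_nat, ← tsum_mul_gammaGF_add_succ c hc, ← (h₁.mul_left _).tsum_mul_left,
    ← (h₂.mul_left _).tsum_mul_left]
  refine tsum_congr fun n => ?_
  rw [hac]
  linear_combination c (n + 1) * (one_add_X_mul_quotCoeff n).1

/-- The total of `γ + (1 - (-1) ^ γ) / 2` in terms of the generating function by `γ`. -/
theorem tsum_weight_mul_gammaGF :
    ∑' m : ℕ, C ((m : ℚ) + (1 - (-1 : ℚ) ^ m) / 2) * gammaGF m =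
      2 * ((∑' m, gammaGF m) * oddDivisorGF) := by
  have e₁ : ∀ n : ℕ, altSign (-2 - (n : ℤ)) * altSign n = 1 := fun n => by
    rw [← altSign_add, ← altSign_add_two_mul _ 1]
    simp
  -- The constant weight folds to 1 + (-1)^n = c (n+1), and c (n+1) + c n = 2.
  have hP := one_add_X_mul_tsum (fun _ => 1) (fun n => 1 - altSign n) (by simp) fun n => by
    rw [Nat.cast_succ, altSign_add_one]; ring
  -- The weight m+1 is odd under m ↦ -2-m, and its extra 1 cancels the -1 coming from the theta
  -- series. Now c (n+1) + c n = 2n + 1 - (-1)^n, twice the wanted weight.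
  have hL := one_add_X_mul_tsum (fun m => (m : ℚ⟦X⟧) + 1) (fun n => n * (1 + altSign n)) (by simp)
    fun n => by rw [Nat.cast_succ, Nat.cast_succ, altSign_add_one]; push_cast; ring
  have c₁ : ∀ n : ℕ, (1 - altSign ((n + 1 : ℕ) : ℤ) + (1 - altSign n)) * gammaGF n =
      2 * gammaGF n := fun n => by
    rw [Nat.cast_succ, altSign_add_one]; ring
  have c₂ : ∀ n : ℕ, (((n + 1 : ℕ) : ℚ⟦X⟧) * (1 + altSign ((n + 1 : ℕ) : ℤ)) + n * (1 + altSign n))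
      * gammaGF n = 2 * (C ((n : ℚ) + (1 - (-1 : ℚ) ^ n) / 2) * gammaGF n) := fun n => by
    have hC : (2 : ℚ⟦X⟧) * C ((n : ℚ) + (1 - (-1 : ℚ) ^ n) / 2) = 2 * n + 1 - (-1) ^ n := by
      rw [show (2 : ℚ⟦X⟧) = C 2 from (map_ofNat C 2).symm, ← map_mul]
      rw [show (2 : ℚ) * ((n : ℚ) + (1 - (-1 : ℚ) ^ n) / 2) = 2 * n + 1 - (-1) ^ n by ring]
      simp
    rw [Nat.cast_succ, Nat.cast_succ, altSign_add_one, altSign_natCast]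
    linear_combination -gammaGF n * hC
  have hw := xNull_gammaGF.mul_left fun m : ℕ => C ((m : ℚ) + (1 - (-1 : ℚ) ^ m) / 2)
  have hT := tsum_intCast_mul_quotCoeff
  simp only [one_mul, add_mul (_ : ℚ⟦X⟧) 1] at hP hL
  rw [(xNull_quotCoeff.mul_left _).summable.tsum_add xNull_quotCoeff.summable, hT] at hL
  rw [tsum_congr c₁, xNull_gammaGF.tsum_mul_left] at hP
  rw [tsum_congr c₂, hw.tsum_mul_left] at hL
  have hq : quotCoeff 0 ≠ 0 := by
    intro h
    rw [h, zero_mul] at hP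
    refine (mul_eq_zero.1 hP).elim (fun h => ?_) tsum_quotCoeff_ne_zero
    simpa using congrArg constantCoeff h
  refine mul_left_cancel₀ (mul_ne_zero two_ne_zero_rat hq) ?_
  linear_combination -hL + 2 * oddDivisorGF * hP

/-! ### Collecting the pairs by γ -/

theorem xNull_subsetGF_mul_maxGF :
    XNull fun p : ℕ × ℕ × ℕ => subsetGF p.1 p.2.1 * maxGF p.1 p.2.2 := fun N =>
  ((Set.finite_lt_nat N).prod ((Set.finite_lt_nat N).prod (Set.finite_lt_nat N))).subset
    fun p hp => by
      have h₁ : p.2.1 < N := by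
        by_contra h
        exact hp (((pow_dvd_pow X (not_lt.1 h)).trans (X_pow_dvd_subsetGF _ _)).mul_right _)
      have h₂ : p.2.2 < N := by
        by_contra h
        exact hp (((pow_dvd_pow X (not_lt.1 h)).trans (X_pow_dvd_maxGF _ _)).mul_left _)
      -- The two X-powers do not bound n; the vanishing of `maxGF` for l < n does.
      have h₃ : p.1 ≤ p.2.2 := by
        by_contra h
        refine hp ?_
        dsimp only
        rw [maxGF_eq_zero (not_le.1 h), mul_zero]
        exact dvd_zero _
      exact ⟨h₃.trans_lt h₂, h₁, h₂⟩

theorem tsum_subsetGF_mul_maxGF (w : ℕ → ℚ⟦X⟧) :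
    ∑' p : ℕ × ℕ × ℕ, w (p.2.1 + p.2.2) * (subsetGF p.1 p.2.1 * maxGF p.1 p.2.2) =
      ∑' m, w m * gammaGF m := by
  have h := xNull_subsetGF_mul_maxGF.mul_left fun p => w (p.2.1 + p.2.2)
  rw [h.tsum_fiber fun p => p.2.1 + p.2.2]
  refine tsum_congr fun m => ?_
  have hm : XNull fun p : ℕ × ℕ × ℕ => if p.2.1 + p.2.2 = m then
      w (p.2.1 + p.2.2) * (subsetGF p.1 p.2.1 * maxGF p.1 p.2.2) else 0 :=
    h.of_dvd fun p => by split_ifs; exacts [dvd_rfl, dvd_zero _]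
  have hp : ∀ n, (∑' p : ℕ × ℕ, if p.1 + p.2 = m then
      w (p.1 + p.2) * (subsetGF n p.1 * maxGF n p.2) else 0) = w m * pairGF n m := by
    intro n
    rw [tsum_eq_sum (s := Finset.HasAntidiagonal.antidiagonal m), pairGF, Finset.mul_sum]
    · refine Finset.sum_congr rfl fun p hp => ?_
      rw [Finset.HasAntidiagonal.mem_antidiagonal] at hp
      rw [if_pos hp, hp]
    · intro p hp
      rw [Finset.HasAntidiagonal.mem_antidiagonal] at hp
      rw [if_neg hp]
  rw [hm.tsum_prod, tsum_congr hp, tsum_eq_sum (s := Finset.range (m + 1)), gammaGF, Finset.mul_sum]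
  intro n hn
  rw [pairGF_eq_zero (by simpa using hn), mul_zero]

/-! ### Lebesgue's identity -/

/-- The triangular number `0 + 1 + ⋯ + n`. -/
def triangle (n : ℕ) : ℕ := ∑ i ∈ Finset.range (n + 1), i

@[simp] theorem triangle_zero : triangle 0 = 0 := by simp [triangle]

theorem triangle_succ (n : ℕ) : triangle (n + 1) = triangle n + (n + 1) :=
  Finset.sum_range_succ _ _

theorem triangle_add (j m : ℕ) : triangle (j + m) = triangle j + triangle m + j * m := by
  induction m with
  | zero => simp
  | succ m ih => rw [← add_assoc, triangle_succ, triangle_succ, ih]; ring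

theorem le_triangle (n : ℕ) : n ≤ triangle n := by
  cases n with
  | zero => simp
  | succ n => rw [triangle_succ]; omega

/-- The q-binomial formula: both sides satisfy `subsetGF_succ_succ'`. -/
theorem subsetGF_add_left (j m : ℕ) :
    subsetGF (j + m) j = X ^ triangle j * (∏ i ∈ Finset.range (j + m), (1 - X ^ (i + 1))) *
      (invPochhammer j * invPochhammer m) := by
  induction j generalizing m with
  | zero => simp [prod_mul_invPochhammer]
  | succ j ihj =>
    induction m with
    | zero =>
      have h := ihj 0
      have h₁ := prod_mul_invPochhammer j
      have h₂ := prod_mul_invPochhammer (j + 1)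
      rw [add_zero] at h
      rw [add_zero, subsetGF_succ_succ', subsetGF_eq_zero (Nat.lt_succ_self j), h, triangle_succ,
        pow_add]
      linear_combination X ^ triangle j * X ^ (j + 1) * invPochhammer 0 * (h₁ - h₂)
    | succ m ihm =>
      have h := ihj (m + 1)
      have e₁ := invPochhammer_succ_mul j
      have e₂ := invPochhammer_succ_mul m
      rw [show j + 1 + (m + 1) = j + 1 + m + 1 by ring, subsetGF_succ_succ', ihm,
        show j + 1 + m = j + (m + 1) by ring, h, triangle_succ, Finset.prod_range_succ, pow_add X
        (triangle j), ← e₁, ← e₂]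
      ring

/-- The generating function of the sets of `n` positive integers. -/
theorem tsum_maxGF (n : ℕ) : ∑' l, maxGF n l = X ^ triangle n * invPochhammer n := by
  have hn : ∀ n, XNull (maxGF n) := fun n => XNull.of_nat (X_pow_dvd_maxGF n)
  induction n with
  | zero =>
    rw [(hn 0).summable.tsum_eq_zero_add]
    simp
  | succ n ih =>
    have h := (hn (n + 1)).summable.tsum_eq_zero_add
    simp only [maxGF_succ_succ'] at h
    rw [((hn (n + 1)).add (hn n)).tsum_mul_left,
      (hn (n + 1)).summable.tsum_add (hn n).summable, ih, maxGF_succ_zero, zero_add] at h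
    have hu : (1 - X ^ (n + 1) : ℚ⟦X⟧) ≠ 0 := fun h => by
      simpa using congrArg constantCoeff h
    refine mul_right_cancel₀ hu ?_
    rw [triangle_succ, pow_add]
    linear_combination h - X ^ triangle n * X ^ (n + 1) * invPochhammer_succ_mul n

/-- The inverse of `(1 - X ^ d) (1 - X ^ (2 d)) ⋯ (1 - X ^ (n d))`. -/
noncomputable def invPochhammerPow (d n : ℕ) : ℚ⟦X⟧ :=
  (∏ i ∈ Finset.range n, (1 - (X ^ d) ^ (i + 1)))⁻¹

theorem prod_mul_invPochhammerPow (d n : ℕ) (hd : d ≠ 0) :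
    (∏ i ∈ Finset.range n, (1 - (X ^ d) ^ (i + 1))) * invPochhammerPow d n = 1 :=
  PowerSeries.mul_inv_cancel _ (by simp [hd])

theorem invPochhammerPow_succ_mul (d n : ℕ) (hd : d ≠ 0) :
    invPochhammerPow d (n + 1) * (1 - (X ^ d) ^ (n + 1)) = invPochhammerPow d n := by
  have h₁ := prod_mul_invPochhammerPow d (n + 1) hd
  have h₂ := prod_mul_invPochhammerPow d n hd
  rw [Finset.prod_range_succ] at h₁
  linear_combination invPochhammerPow d n * h₁ -
    invPochhammerPow d (n + 1) * (1 - (X ^ d) ^ (n + 1)) * h₂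

theorem invPochhammerPow_one (n : ℕ) : invPochhammerPow 1 n = invPochhammer n := by
  simp [invPochhammerPow, invPochhammer]

theorem prod_one_add_mul_invPochhammerPow_two (n : ℕ) :
    (∏ i ∈ Finset.range n, (1 + X ^ (i + 1))) * invPochhammerPow 2 n = invPochhammer n := by
  have h₁ := prod_mul_invPochhammerPow 2 n two_ne_zero
  have h₂ := prod_mul_invPochhammer n
  have h : (∏ i ∈ Finset.range n, (1 - (X ^ 2) ^ (i + 1)) : ℚ⟦X⟧) =
      (∏ i ∈ Finset.range n, (1 - X ^ (i + 1))) * ∏ i ∈ Finset.range n, (1 + X ^ (i + 1)) := by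
    rw [← Finset.prod_mul_distrib]
    exact Finset.prod_congr rfl fun i _ => by ring
  rw [h] at h₁
  linear_combination invPochhammer n * h₁ -
    (∏ i ∈ Finset.range n, (1 + X ^ (i + 1))) * invPochhammerPow 2 n * h₂

/-- Euler's series for `∏ i > n, (1 + X ^ (d i))`. -/
noncomputable def eulerSum (d n : ℕ) : ℚ⟦X⟧ :=
  ∑' m, (X ^ d) ^ (triangle m + n * m) * invPochhammerPow d m

theorem xNull_eulerSum (d n : ℕ) (hd : d ≠ 0) :
    XNull fun m => (X ^ d : ℚ⟦X⟧) ^ (triangle m + n * m) * invPochhammerPow d m :=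
  (XNull.of_nat fun m => by
    rw [← pow_mul]
    exact pow_dvd_pow X ((le_triangle m).trans ((Nat.le_add_right _ (n * m)).trans
      (Nat.le_mul_of_pos_left _ (Nat.pos_of_ne_zero hd))))).mul_right _

/-- Subtracting the sum at n+1 from that at n puts a factor 1 - X^(dm) on term m, which cancels the
last factor of its denominator; the index then shifts by one. -/
theorem eulerSum_eq (d n : ℕ) (hd : d ≠ 0) :
    eulerSum d n = (1 + (X ^ d) ^ (n + 1)) * eulerSum d (n + 1) := by
  have h₀ := xNull_eulerSum d n hd
  have h₁ := xNull_eulerSum d (n + 1) hd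
  have hs := (h₀.add (h₁.mul_left fun _ => -1)).summable.tsum_eq_zero_add
  have ht : ∀ m : ℕ, (X ^ d) ^ (triangle (m + 1) + n * (m + 1)) * invPochhammerPow d (m + 1) +
      -1 * ((X ^ d) ^ (triangle (m + 1) + (n + 1) * (m + 1)) * invPochhammerPow d (m + 1)) =
      (X ^ d) ^ (n + 1) * ((X ^ d) ^ (triangle m + (n + 1) * m) * invPochhammerPow d m) := by
    intro m
    rw [triangle_succ, ← invPochhammerPow_succ_mul d m hd]
    ring
  rw [tsum_congr ht, h₁.tsum_mul_left, h₀.summable.tsum_add (h₁.mul_left _).summable,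
    h₁.tsum_mul_left] at hs
  simp only [eulerSum]
  simp only [mul_zero, triangle_zero] at hs
  linear_combination hs

theorem eulerSum_zero (d n : ℕ) (hd : d ≠ 0) :
    eulerSum d 0 = (∏ i ∈ Finset.range n, (1 + (X ^ d) ^ (i + 1))) * eulerSum d n := by
  induction n with
  | zero => simp
  | succ n ih => rw [ih, Finset.prod_range_succ, mul_assoc, ← eulerSum_eq d n hd]

theorem X_pow_dvd_eulerSum_sub_one (d n : ℕ) (hd : d ≠ 0) : X ^ n ∣ eulerSum d n - 1 := by
  rw [eulerSum, (xNull_eulerSum d n hd).summable.tsum_eq_zero_add]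
  simp only [triangle_zero, mul_zero, add_zero, pow_zero, one_mul]
  rw [show invPochhammerPow d 0 = 1 by simp [invPochhammerPow], add_sub_cancel_left]
  refine X_pow_dvd_tsum fun m => Dvd.dvd.mul_right ?_ _
  rw [← pow_mul]
  refine pow_dvd_pow X (le_trans ?_ (Nat.le_mul_of_pos_left _ (Nat.pos_of_ne_zero hd)))
  nlinarith

theorem X_pow_dvd_eulerSum_zero_sub (d n : ℕ) (hd : d ≠ 0) :
    X ^ n ∣ eulerSum d 0 - ∏ i ∈ Finset.range n, (1 + (X ^ d) ^ (i + 1)) := by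
  rw [eulerSum_zero d n hd, ← mul_sub_one]
  exact (X_pow_dvd_eulerSum_sub_one d n hd).mul_left _

/-- Lebesgue's identity. -/
theorem tsum_gammaGF : ∑' m, gammaGF m = eulerSum 1 0 * eulerSum 2 0 := by
  have h₀ := xNull_subsetGF_mul_maxGF
  have h : XNull fun p : ℕ × ℕ => subsetGF p.1 p.2 * ∑' l, maxGF p.1 l := by
    have h₁ := (h₀.comp_injective (Equiv.prodAssoc ℕ ℕ ℕ).injective).tsum_slice
    refine h₁.of_dvd fun p => ?_
    have hn : XNull (maxGF p.1) := XNull.of_nat (X_pow_dvd_maxGF p.1)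
    rw [← hn.tsum_mul_left]
    exact dvd_rfl
  have h₁ := tsum_subsetGF_mul_maxGF fun _ => 1
  simp only [one_mul] at h₁
  rw [← h₁, ← (Equiv.prodAssoc ℕ ℕ ℕ).tsum_eq,
    (h₀.comp_injective (Equiv.prodAssoc ℕ ℕ ℕ).injective).tsum_prod]
  have h₂ : ∀ p : ℕ × ℕ, ∑' l, subsetGF p.1 p.2 * maxGF p.1 l =
      subsetGF p.1 p.2 * ∑' l, maxGF p.1 l := fun p =>
    (XNull.of_nat (X_pow_dvd_maxGF p.1)).tsum_mul_left _
  -- For fixed j put n = j+m. The factor (1 - X)⋯(1 - X^n) cancels, the sum over m is Euler's series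
  -- for ∏_{i>j} (1 + X^i), and the missing factors i ≤ j turn 1/∏ (1 - X^i) into 1/∏ (1 - X^(2i)).
  have h₃ : ∀ j, ∑' n, subsetGF n j * ∑' l, maxGF n l =
      eulerSum 1 0 * ((X ^ 2) ^ (triangle j + 0 * j) * invPochhammerPow 2 j) := by
    intro j
    have hs : XNull fun n => subsetGF n j * ∑' l, maxGF n l :=
      h.comp_injective (Prod.mk_left_injective j)
    rw [← hs.summable.sum_add_tsum_nat_add j, Finset.sum_eq_zero, zero_add]
    · have ht : ∀ m, subsetGF (m + j) j * ∑' l, maxGF (m + j) l =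
          (X ^ 2) ^ triangle j * invPochhammer j *
            ((X ^ 1) ^ (triangle m + j * m) * invPochhammerPow 1 m) := by
        intro m
        rw [add_comm m j, subsetGF_add_left, tsum_maxGF, triangle_add, invPochhammerPow_one]
        have hp := prod_mul_invPochhammer (j + m)
        generalize ∏ i ∈ Finset.range (j + m), (1 - (X : ℚ⟦X⟧) ^ (i + 1)) = Q at hp ⊢
        simp only [pow_add, pow_one]
        linear_combination X ^ triangle j * (invPochhammer j * invPochhammer m) *
          (X ^ triangle j * X ^ triangle m * X ^ (j * m)) * hp
      rw [tsum_congr ht, (xNull_eulerSum 1 j one_ne_zero).tsum_mul_left, ← eulerSum,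
        eulerSum_zero 1 j one_ne_zero, ← prod_one_add_mul_invPochhammerPow_two]
      simp only [pow_one, zero_mul, add_zero]
      ring
    · intro n hn
      rw [subsetGF_eq_zero (Finset.mem_range.1 hn), zero_mul]
  refine (tsum_congr h₂).trans ?_
  rw [h.tsum_prod, h.tsum_comm, tsum_congr h₃,
    (xNull_eulerSum 2 0 two_ne_zero).tsum_mul_left, ← eulerSum]

/-! ### Product formula for partitions without repeated even parts -/

/-- The generating function of the partitions without repeated even parts. -/
noncomputable def distinctEvenGF : ℚ⟦X⟧ :=
  Nat.Partition.genFun fun i j => if Even i → j = 1 then 1 else 0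

/-- The factor of `distinctEvenGF` that accounts for the parts equal to `i + 1`. -/
noncomputable def distinctEvenFactor (i : ℕ) : ℚ⟦X⟧ :=
  1 + ∑' j : ℕ, (if Even (i + 1) → j + 1 = 1 then (1 : ℚ) else 0) • X ^ ((i + 1) * (j + 1))

theorem hasProd_distinctEvenFactor : HasProd distinctEvenFactor distinctEvenGF :=
  Nat.Partition.hasProd_genFun fun i j => if Even i → j = 1 then (1 : ℚ) else 0

/-- An even index 2k stands for the odd part 2k+1, whence a full geometric series. -/
theorem distinctEvenFactor_even (k : ℕ) :
    distinctEvenFactor (2 * k) * (1 - X ^ (2 * k + 1)) = 1 := by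
  have hk : ¬ Even (2 * k + 1) := by simp
  have h₀ : constantCoeff ((X : ℚ⟦X⟧) ^ (2 * k + 1)) = 0 := by simp
  have hs := WithPiTopology.summable_pow_of_constantCoeff_eq_zero h₀
  have h := WithPiTopology.tsum_pow_mul_one_sub_of_constantCoeff_eq_zero h₀
  rw [hs.tsum_eq_zero_add, pow_zero] at h
  simpa [distinctEvenFactor, hk, pow_mul] using h

theorem distinctEvenFactor_odd (k : ℕ) :
    distinctEvenFactor (2 * k + 1) = 1 + (X ^ 2) ^ (k + 1) := by
  have hk : Even (2 * k + 1 + 1) := ⟨k + 1, by ring⟩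
  rw [distinctEvenFactor, tsum_eq_single 0]
  · simp [hk]
    ring
  · intro j hj
    simp [hk, hj]

theorem prod_distinctEvenFactor (n : ℕ) :
    (∏ i ∈ Finset.range (2 * n), distinctEvenFactor i) *
      ∏ i ∈ Finset.range n, (1 - X ^ (2 * i + 1)) =
    ∏ i ∈ Finset.range n, (1 + (X ^ 2) ^ (i + 1)) := by
  induction n with
  | zero => simp
  | succ n ih =>
    rw [show 2 * (n + 1) = 2 * n + 1 + 1 by ring]
    simp only [Finset.prod_range_succ]
    rw [distinctEvenFactor_odd, ← ih]
    linear_combination (∏ i ∈ Finset.range (2 * n), distinctEvenFactor i) *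
      (∏ i ∈ Finset.range n, (1 - X ^ (2 * i + 1))) * (1 + (X ^ 2) ^ (n + 1)) *
      distinctEvenFactor_even n

/-- Finite form of Euler's theorem on odd and distinct parts; the right side is 1 modulo X^n. -/
theorem prod_one_add_mul_prod_one_sub_odd (n : ℕ) :
    (∏ i ∈ Finset.range n, (1 + X ^ (i + 1)) : ℚ⟦X⟧) *
      ∏ i ∈ Finset.range n, (1 - X ^ (2 * i + 1)) =
    ∏ i ∈ Finset.range n, (1 - X ^ (n + i + 1)) := by
  have h : (∏ i ∈ Finset.range n, (1 - X ^ (i + 1)) : ℚ⟦X⟧) *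
      ((∏ i ∈ Finset.range n, (1 + X ^ (i + 1))) * ∏ i ∈ Finset.range n, (1 - X ^ (2 * i + 1))) =
      ∏ i ∈ Finset.range (2 * n), (1 - X ^ (i + 1)) := by
    induction n with
    | zero => simp
    | succ n ih =>
      rw [show 2 * (n + 1) = 2 * n + 1 + 1 by ring]
      simp only [Finset.prod_range_succ]
      rw [← ih]
      ring
  rw [two_mul, Finset.prod_range_add] at h
  refine mul_left_cancel₀ (left_ne_zero_of_mul_eq_one (prod_mul_invPochhammer n)) h

theorem X_pow_dvd_prod_sub_one (n m : ℕ) :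
    X ^ n ∣ (∏ i ∈ Finset.range m, (1 - X ^ (n + i + 1)) : ℚ⟦X⟧) - 1 := by
  induction m with
  | zero => simp
  | succ m ih =>
    rw [Finset.prod_range_succ, mul_sub, mul_one, sub_right_comm]
    exact dvd_sub ih ((pow_dvd_pow X (by omega)).mul_left _)

theorem eulerSum_mul_eulerSum : eulerSum 1 0 * eulerSum 2 0 = distinctEvenGF := by
  have hlim : Filter.Tendsto (fun n => ∏ i ∈ Finset.range (2 * n), distinctEvenFactor i)
      Filter.atTop (nhds distinctEvenGF) :=
    hasProd_distinctEvenFactor.tendsto_prod_nat.comp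
      (Filter.tendsto_atTop_mono (fun n : ℕ => (by omega : n ≤ 2 * n)) Filter.tendsto_id)
  have hdvd : ∀ n, X ^ n ∣ eulerSum 1 0 * eulerSum 2 0 -
      ∏ i ∈ Finset.range (2 * n), distinctEvenFactor i := by
    intro n
    have h₁ := X_pow_dvd_eulerSum_zero_sub 1 n one_ne_zero
    have h₂ := X_pow_dvd_eulerSum_zero_sub 2 n two_ne_zero
    have h₃ := X_pow_dvd_prod_sub_one n n
    rw [← prod_one_add_mul_prod_one_sub_odd] at h₃
    rw [← prod_distinctEvenFactor] at h₂
    simp only [pow_one] at h₁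
    generalize ∏ i ∈ Finset.range (2 * n), distinctEvenFactor i = A at h₂ ⊢
    generalize ∏ i ∈ Finset.range n, (1 + (X : ℚ⟦X⟧) ^ (i + 1)) = B at h₁ h₃
    generalize ∏ i ∈ Finset.range n, (1 - (X : ℚ⟦X⟧) ^ (2 * i + 1)) = D at h₂ h₃
    -- Modulo X^n the two Euler sums are B and A D, and B D is 1.
    have e : eulerSum 1 0 * eulerSum 2 0 - A = (eulerSum 1 0 - B) * eulerSum 2 0 +
        B * (eulerSum 2 0 - A * D) + A * (B * D - 1) := by ring
    rw [e]
    exact dvd_add (dvd_add (h₁.mul_right _) (h₂.mul_left _)) (h₃.mul_left _)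
  ext d
  rw [WithPiTopology.tendsto_iff_coeff_tendsto] at hlim
  refine tendsto_nhds_unique (tendsto_const_nhds.congr' ?_) (hlim d)
  filter_upwards [Filter.eventually_gt_atTop d] with n hn
  have h := X_pow_dvd_iff.1 (hdvd n) d hn
  rwa [map_sub, sub_eq_zero] at h

theorem tsum_gammaGF_eq_distinctEvenGF : ∑' m, gammaGF m = distinctEvenGF :=
  tsum_gammaGF.trans eulerSum_mul_eulerSum

end PowerSeries

/-! ### From power series to partitions -/

namespace IntPartition

open PowerSeries

/-- The partition with a given multiset of positive parts. -/
def ofMultiset (s : Multiset ℕ) (h : ∀ i ∈ s, 0 < i) : IntPartition :=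
  ⟨s.sum, s, fun {i} hi => h i hi, rfl⟩

@[simp] theorem parts_ofMultiset (s : Multiset ℕ) (h : ∀ i ∈ s, 0 < i) :
    (ofMultiset s h).parts = s := rfl

theorem size_eq_sum (π : IntPartition) : π.size = π.parts.sum := π.2.parts_sum.symm

theorem pos_of_mem_parts {π : IntPartition} {i : ℕ} (h : i ∈ π.parts) : 0 < i := π.2.parts_pos h

theorem parts_injective : Function.Injective parts := by
  intro π π' h
  obtain ⟨m, p⟩ := π
  obtain ⟨m', p'⟩ := π'
  obtain rfl : m = m' := by rw [← p.parts_sum, ← p'.parts_sum]; exact congrArg Multiset.sum h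
  exact congrArg (Sigma.mk m) (Nat.Partition.ext h)

theorem xNull_X_pow_size : XNull fun π : IntPartition => (X : ℚ⟦X⟧) ^ π.size := fun N =>
  ((Set.finite_lt_nat N).biUnion fun m _ =>
    Set.finite_range (Sigma.mk m : Nat.Partition m → IntPartition)).subset fun π hπ => by
      have h : π.1 < N := by
        by_contra h
        exact hπ (pow_dvd_pow X (not_lt.1 h))
      exact Set.mem_biUnion h ⟨π.2, rfl⟩

/-! ### Sums over partitions into distinct parts -/

/-- The partition whose parts are the elements of a finite set. -/
def ofFinset (S : Finset ℕ) (h : ∀ i ∈ S, 0 < i) : IntPartition := ofMultiset S.val h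

theorem size_ofFinset (S : Finset ℕ) (h : ∀ i ∈ S, 0 < i) : (ofFinset S h).size = ∑ i ∈ S, i := by
  rw [size_eq_sum, ofFinset, parts_ofMultiset, Finset.sum_eq_multiset_sum, Multiset.map_id']

theorem tsum_distinctLe (n j : ℕ) :
    ∑' π : distinctLe n, (if π.1.numParts = j then (X : ℚ⟦X⟧) ^ π.1.size else 0) =
      subsetGF n j := by
  have hpos : ∀ S : {S // S ∈ (Finset.Icc 1 n).powersetCard j}, ∀ i ∈ S.1, 0 < i :=
    fun S i hi => (Finset.mem_Icc.1 ((Finset.mem_powersetCard.1 S.2).1 hi)).1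
  let φ : {S // S ∈ (Finset.Icc 1 n).powersetCard j} → distinctLe n := fun S =>
    ⟨ofFinset S.1 (hpos S), S.1.nodup,
      fun i hi => (Finset.mem_Icc.1 ((Finset.mem_powersetCard.1 S.2).1 hi)).2⟩
  have hφ : Function.Injective φ := fun S T h =>
    Subtype.ext (Finset.val_injective (congrArg (fun π : distinctLe n => π.1.parts) h))
  rw [subsetGF_eq_sum, ← Finset.tsum_subtype, ← hφ.tsum_eq]
  · refine tsum_congr fun S => ?_
    rw [if_pos (show (φ S).1.numParts = j from (Finset.mem_powersetCard.1 S.2).2), size_ofFinset]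
  · intro π hπ
    have hj : π.1.numParts = j := by
      by_contra h
      exact hπ (if_neg h)
    refine ⟨⟨⟨π.1.parts, π.2.1⟩, Finset.mem_powersetCard.2 ⟨fun i hi => ?_, hj⟩⟩, ?_⟩
    · exact Finset.mem_Icc.2 ⟨pos_of_mem_parts hi, π.2.2 i hi⟩
    · exact Subtype.ext (parts_injective rfl)

theorem le_largestPart {π : IntPartition} {i : ℕ} (h : i ∈ π.parts) : i ≤ π.largestPart :=
  Multiset.le_sup h

theorem largestPart_mem {π : IntPartition} (h : π.largestPart ≠ 0) :
    π.largestPart ∈ π.parts := by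
  by_contra hm
  have hlt : π.parts.sup ≤ π.largestPart - 1 := Multiset.sup_le.2 fun i hi => by
    have h₁ := le_largestPart hi
    have h₂ : i ≠ π.largestPart := fun h => hm (h ▸ hi)
    omega
  change π.largestPart ≤ _ at hlt
  omega

theorem tsum_distinctCard_succ (n l : ℕ) :
    ∑' π : distinctCard (n + 1), (if π.1.largestPart = l + 1 then (X : ℚ⟦X⟧) ^ π.1.size else 0) =
      X ^ (l + 1) * subsetGF l n := by
  have hmem : ∀ S : {S // S ∈ (Finset.Icc 1 l).powersetCard n}, l + 1 ∉ S.1 := fun S h => by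
    have := (Finset.mem_Icc.1 ((Finset.mem_powersetCard.1 S.2).1 h)).2
    omega
  have hpos : ∀ S : {S // S ∈ (Finset.Icc 1 l).powersetCard n}, ∀ i ∈ insert (l + 1) S.1, 0 < i :=
    fun S i hi => (Finset.mem_insert.1 hi).elim (fun h => h ▸ Nat.succ_pos l) fun h =>
      (Finset.mem_Icc.1 ((Finset.mem_powersetCard.1 S.2).1 h)).1
  let φ : {S // S ∈ (Finset.Icc 1 l).powersetCard n} → distinctCard (n + 1) := fun S =>
    ⟨ofFinset (insert (l + 1) S.1) (hpos S), (insert (l + 1) S.1).nodup, by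
      change (insert (l + 1) S.1).card = n + 1
      rw [Finset.card_insert_of_notMem (hmem S), (Finset.mem_powersetCard.1 S.2).2]⟩
  have hφ : Function.Injective φ := fun S T h => by
    have h' : insert (l + 1) S.1 = insert (l + 1) T.1 :=
      Finset.val_injective (congrArg (fun π : distinctCard (n + 1) => π.1.parts) h)
    refine Subtype.ext ?_
    rw [← Finset.erase_insert (hmem S), ← Finset.erase_insert (hmem T), h']
  have hmax : ∀ S, (φ S).1.largestPart = l + 1 := fun S => by
    refine le_antisymm (Multiset.sup_le.2 fun i hi => ?_)
      (le_largestPart (Finset.mem_insert_self (l + 1) S.1))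
    rcases Finset.mem_insert.1 (show i ∈ insert (l + 1) S.1 from hi) with h | h
    · exact h.le
    · exact ((Finset.mem_Icc.1 ((Finset.mem_powersetCard.1 S.2).1 h)).2).trans (Nat.le_succ l)
  rw [subsetGF_eq_sum, Finset.mul_sum, ← Finset.tsum_subtype, ← hφ.tsum_eq]
  · refine tsum_congr fun S => ?_
    rw [if_pos (hmax S), size_ofFinset, Finset.sum_insert (hmem S), pow_add X (l + 1)]
  · intro π hπ
    have hl : π.1.largestPart = l + 1 := by
      by_contra h
      exact hπ (if_neg h)
    let T : Finset ℕ := ⟨π.1.parts, π.2.1⟩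
    have hlT : l + 1 ∈ T := by
      have := largestPart_mem (π := π.1) (by omega)
      rwa [hl] at this
    refine ⟨⟨T.erase (l + 1), Finset.mem_powersetCard.2 ⟨fun i hi => ?_, ?_⟩⟩, ?_⟩
    · obtain ⟨hne, hi⟩ := Finset.mem_erase.1 hi
      have h₁ := le_largestPart (show i ∈ π.1.parts from hi)
      exact Finset.mem_Icc.2 ⟨pos_of_mem_parts (show i ∈ π.1.parts from hi), by omega⟩
    · rw [Finset.card_erase_of_mem hlT, show T.card = n + 1 from π.2.2, Nat.add_sub_cancel]
    · refine Subtype.ext (parts_injective ?_)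
      change (insert (l + 1) (T.erase (l + 1))).val = T.val
      rw [Finset.insert_erase hlT]

theorem tsum_distinctCard (n l : ℕ) :
    ∑' π : distinctCard n, (if π.1.largestPart = l then (X : ℚ⟦X⟧) ^ π.1.size else 0) =
      maxGF n l := by
  cases n with
  | zero =>
    have hparts : ∀ π : distinctCard 0, π.1.parts = 0 := fun π => Multiset.card_eq_zero.1 π.2.2
    have hmax : ∀ π : distinctCard 0, π.1.largestPart = 0 := fun π => by
      rw [largestPart, hparts]; rfl
    have hsize : ∀ π : distinctCard 0, π.1.size = 0 := fun π => by
      rw [size_eq_sum, hparts]; rfl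
    cases l with
    | zero =>
      let π₀ : distinctCard 0 := ⟨ofMultiset 0 (by simp), by simp [distinctCard, numParts]⟩
      rw [tsum_eq_single π₀, if_pos (hmax _), hsize]
      · simp
      · intro π hπ
        exact absurd (Subtype.ext (parts_injective ((hparts π).trans (hparts π₀).symm))) hπ
    | succ l => simp [hmax]
  | succ n =>
    cases l with
    | zero =>
      refine (tsum_congr fun π => if_neg fun h => ?_).trans tsum_zero
      have hc : 0 < Multiset.card π.1.parts := by
        rw [show Multiset.card π.1.parts = n + 1 from π.2.2]
        exact Nat.succ_pos n
      obtain ⟨i, hi⟩ := Multiset.card_pos_iff_exists_mem.1 hc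
      have h₁ := le_largestPart hi
      have h₂ := pos_of_mem_parts hi
      omega
    | succ l => rw [tsum_distinctCard_succ, maxGF_succ_succ]

/-- The weight `γ + (1 - (-1) ^ γ) / 2`, as a constant power series. -/
noncomputable def gammaWeight (m : ℕ) : ℚ⟦X⟧ := C ((m : ℚ) + (1 - (-1 : ℚ) ^ m) / 2)

theorem pairTerm_eq (π₁ π₂ : IntPartition) :
    pairTerm π₁ π₂ = gammaWeight (π₁.numParts + π₂.largestPart) * (X ^ π₁.size * X ^ π₂.size) := by
  rw [pairTerm, gamma, gammaWeight, pow_add (X : ℚ⟦X⟧), add_comm π₁.numParts]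

/-- The index n is the number of parts of π₂, so the disjoint union over n embeds into the pairs of
partitions. -/
theorem xNull_pairTerm_sigma :
    XNull fun p : Σ n : ℕ, distinctLe n × distinctCard n => pairTerm p.2.1 p.2.2 := by
  have he : Function.Injective fun p : Σ n : ℕ, distinctLe n × distinctCard n =>
      ((p.2.1 : IntPartition), (p.2.2 : IntPartition)) := by
    rintro ⟨n, ⟨a, ha⟩, ⟨b, hb⟩⟩ ⟨n', ⟨a', ha'⟩, ⟨b', hb'⟩⟩ h
    obtain ⟨rfl, rfl⟩ := Prod.mk.inj h
    obtain rfl : n = n' := hb.2.symm.trans hb'.2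
    rfl
  refine ((xNull_X_pow_size.prod_mul xNull_X_pow_size).comp_injective he).of_dvd fun p => ?_
  rw [pairTerm_eq]
  exact dvd_mul_left _ _

theorem xNull_X_pow_size_subtype (s : Set IntPartition) :
    XNull fun π : s => (X : ℚ⟦X⟧) ^ π.1.size :=
  xNull_X_pow_size.comp_injective Subtype.val_injective

theorem xNull_pairTerm (n : ℕ) :
    XNull fun p : distinctLe n × distinctCard n => pairTerm p.1 p.2 :=
  ((xNull_X_pow_size_subtype _).prod_mul (xNull_X_pow_size_subtype _)).of_dvd fun p => by
    rw [pairTerm_eq]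
    exact dvd_mul_left _ _

theorem tsum_pairTerm (n : ℕ) :
    ∑' p : distinctLe n × distinctCard n, pairTerm p.1 p.2 =
      ∑' p : ℕ × ℕ, gammaWeight (p.1 + p.2) * (subsetGF n p.1 * maxGF n p.2) := by
  rw [(xNull_pairTerm n).tsum_fiber fun p => (p.1.1.numParts, p.2.1.largestPart)]
  refine tsum_congr fun q => ?_
  have h₁ : XNull fun π : distinctLe n => if π.1.numParts = q.1 then (X : ℚ⟦X⟧) ^ π.1.size else 0 :=
    (xNull_X_pow_size_subtype _).of_dvd fun π => by
      split_ifs; exacts [dvd_rfl, dvd_zero _]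
  have h₂ : XNull fun π : distinctCard n =>
      if π.1.largestPart = q.2 then (X : ℚ⟦X⟧) ^ π.1.size else 0 :=
    (xNull_X_pow_size_subtype _).of_dvd fun π => by
      split_ifs; exacts [dvd_rfl, dvd_zero _]
  rw [← tsum_distinctLe, ← tsum_distinctCard, h₁.tsum_mul_tsum h₂, ← (h₁.prod_mul h₂).tsum_mul_left]
  refine tsum_congr fun p => ?_
  rw [pairTerm_eq]
  by_cases ha : p.1.1.numParts = q.1 <;> by_cases hb : p.2.1.largestPart = q.2 <;>
    simp [ha, hb, Prod.ext_iff]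

theorem hasSum_tsum_pairTerm :
    HasSum (fun n => ∑' p : distinctLe n × distinctCard n, pairTerm p.1 p.2)
      (∑' m, gammaWeight m * gammaGF m) := by
  have h := xNull_pairTerm_sigma.summable.hasSum.sigma fun n => (xNull_pairTerm n).summable.hasSum
  convert h using 1
  have h₁ := xNull_subsetGF_mul_maxGF.mul_left fun p => gammaWeight (p.2.1 + p.2.2)
  rw [← h.tsum_eq, ← tsum_subsetGF_mul_maxGF, h₁.tsum_prod]
  exact tsum_congr fun n => (tsum_pairTerm n).symm

/-! ### Sums over partitions without repeated even parts -/

theorem tsum_distinctEven : ∑' π : distinctEven, (X : ℚ⟦X⟧) ^ π.1.size = distinctEvenGF := by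
  classical
  have h : XNull (distinctEven.indicator fun π : IntPartition => (X : ℚ⟦X⟧) ^ π.size) :=
    xNull_X_pow_size.of_dvd fun π => by
      by_cases hπ : π ∈ distinctEven <;> simp [hπ]
  have h' : ∀ m, Summable fun p : Nat.Partition m =>
      distinctEven.indicator (fun π : IntPartition => (X : ℚ⟦X⟧) ^ π.size) ⟨m, p⟩ :=
    fun m => (XNull.of_finite _).summable
  rw [tsum_subtype distinctEven fun π : IntPartition => (X : ℚ⟦X⟧) ^ π.size,
    Summable.tsum_sigma' (γ := Nat.Partition) h' h.summable,
    as_tsum distinctEvenGF]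
  refine tsum_congr fun m => ?_
  rw [tsum_fintype, distinctEvenGF, Nat.Partition.coeff_genFun, map_sum]
  refine Finset.sum_congr rfl fun p _ => ?_
  by_cases hp : (⟨m, p⟩ : IntPartition) ∈ distinctEven
  · rw [Set.indicator_of_mem hp, Finsupp.prod, Finset.prod_eq_one, X_pow_eq]
    · rfl
    · intro i hi
      have hi' : i ∈ p.parts := by simpa using hi
      exact if_pos (hp i hi')
  · have hex : ∃ i ∈ p.parts, ¬ (Even i → p.parts.count i = 1) := by
      by_contra h
      exact hp fun i hi => not_not.1 fun hi' => h ⟨i, hi, hi'⟩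
    obtain ⟨i, hi, hi'⟩ := hex
    rw [Set.indicator_of_notMem hp, Finsupp.prod, Finset.prod_eq_zero (i := i), map_zero]
    · simpa using hi
    · exact if_neg hi'

theorem hasSum_count_odd (s : Multiset ℕ) :
    HasSum (fun k => (s.count (2 * k + 1) : ℚ⟦X⟧)) (s.countP fun i => Odd i) := by
  induction s using Multiset.induction with
  | empty => simp
  | cons a s ih =>
    simp only [Multiset.count_cons, Multiset.countP_cons, Nat.cast_add]
    refine ih.add ?_
    by_cases ha : Odd a
    · obtain ⟨k, rfl⟩ := ha
      have h := hasSum_ite_eq k (1 : ℚ⟦X⟧)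
      simpa [Nat.cast_ite] using h
    · have h : ∀ k, 2 * k + 1 ≠ a := fun k hk => ha ⟨k, hk.symm⟩
      simp [ha, h]

/-- Adjoining `j + 1` parts equal to `2 k + 1`. -/
def adjoinOdd (π : IntPartition) (j k : ℕ) : IntPartition :=
  ofMultiset (π.parts + Multiset.replicate (j + 1) (2 * k + 1)) fun i hi => by
    rcases Multiset.mem_add.1 hi with h | h
    · exact pos_of_mem_parts h
    · rw [Multiset.eq_of_mem_replicate h]; exact Nat.succ_pos _

theorem parts_adjoinOdd (π : IntPartition) (j k : ℕ) :
    (π.adjoinOdd j k).parts = π.parts + Multiset.replicate (j + 1) (2 * k + 1) := rfl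

theorem size_adjoinOdd (π : IntPartition) (j k : ℕ) :
    (π.adjoinOdd j k).size = π.size + (j + 1) * (2 * k + 1) := by
  rw [size_eq_sum, parts_adjoinOdd, Multiset.sum_add, ← size_eq_sum, Multiset.sum_replicate,
    smul_eq_mul]

theorem adjoinOdd_mem_distinctEven {π : IntPartition} (h : π ∈ distinctEven) (j k : ℕ) :
    π.adjoinOdd j k ∈ distinctEven := by
  intro i hi he
  have hne : i ≠ 2 * k + 1 := by
    rintro rfl
    simp at he
  rw [parts_adjoinOdd] at hi ⊢
  rw [Multiset.count_add, Multiset.count_replicate, if_neg hne.symm, add_zero]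
  refine h i ((Multiset.mem_add.1 hi).resolve_right fun h => hne ?_) he
  exact Multiset.eq_of_mem_replicate h

/-- Deleting copies of an odd part leaves the multiplicities of even parts alone. -/
theorem exists_adjoinOdd {π : IntPartition} (h : π ∈ distinctEven) {j k : ℕ}
    (hjk : j < π.parts.count (2 * k + 1)) : ∃ π' ∈ distinctEven, π'.adjoinOdd j k = π := by
  have hle : Multiset.replicate (j + 1) (2 * k + 1) ≤ π.parts :=
    Multiset.le_count_iff_replicate_le.1 hjk
  have hsub : π.parts - Multiset.replicate (j + 1) (2 * k + 1) ≤ π.parts := tsub_le_self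
  refine ⟨ofMultiset (π.parts - Multiset.replicate (j + 1) (2 * k + 1))
    fun i hi => pos_of_mem_parts (Multiset.mem_of_le hsub hi), ?_, parts_injective ?_⟩
  · intro i hi he
    have hne : i ≠ 2 * k + 1 := by
      rintro rfl
      simp at he
    rw [parts_ofMultiset] at hi ⊢
    rw [Multiset.count_sub, Multiset.count_replicate, if_neg hne.symm, Nat.sub_zero]
    exact h i (Multiset.mem_of_le hsub hi) he
  · rw [parts_adjoinOdd, parts_ofMultiset, tsub_add_cancel_of_le hle]

theorem xNull_oddTerm : XNull fun π : distinctEven => oddTerm π :=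
  (xNull_X_pow_size_subtype _).mul_left fun π => C (π.1.numOddParts : ℚ)

theorem tsum_oddTerm :
    ∑' π : distinctEven, oddTerm π = distinctEvenGF * oddDivisorGF := by
  have h₀ := xNull_X_pow_size_subtype distinctEven
  -- Summed over (j, k), f counts the odd parts of π; summed through φ, it factors as a product.
  let f : distinctEven × ℕ × ℕ → ℚ⟦X⟧ := fun p =>
    if p.2.1 < p.1.1.parts.count (2 * p.2.2 + 1) then X ^ p.1.1.size else 0
  let φ : distinctEven × ℕ × ℕ → distinctEven × ℕ × ℕ := fun p =>
    (⟨p.1.1.adjoinOdd p.2.1 p.2.2, adjoinOdd_mem_distinctEven p.1.2 _ _⟩, p.2)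
  have hφ : Function.Injective φ := by
    rintro ⟨⟨π, hπ⟩, q⟩ ⟨⟨π', hπ'⟩, q'⟩ h
    obtain ⟨h₁, rfl⟩ := Prod.mk.inj h
    have h₂ := congrArg (fun π : distinctEven => π.1.parts) h₁
    simp only [parts_adjoinOdd, add_left_inj] at h₂
    obtain rfl := parts_injective h₂
    rfl
  have hsupp : ∀ p, f p ≠ 0 → p ∈ Set.range φ := by
    rintro ⟨⟨π, hπ⟩, j, k⟩ hp
    have hjk : j < π.parts.count (2 * k + 1) := by
      by_contra h
      exact hp (if_neg h)
    obtain ⟨π', hπ', rfl⟩ := exists_adjoinOdd hπ hjk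
    exact ⟨(⟨π', hπ'⟩, j, k), rfl⟩
  have hfφ : ∀ p, f (φ p) = X ^ p.1.1.size * X ^ ((p.2.1 + 1) * (2 * p.2.2 + 1)) := by
    intro p
    simp only [f, φ, parts_adjoinOdd, Multiset.count_add, Multiset.count_replicate_self,
      size_adjoinOdd]
    rw [if_pos (by omega), pow_add]
  have hf : XNull f := fun N =>
    ((h₀.prod_mul xNull_oddDivisor N).image φ).subset fun p hp => by
      obtain ⟨q, rfl⟩ := hsupp p fun h => hp (h ▸ dvd_zero _)
      exact ⟨q, fun h => hp ((hfφ q).symm ▸ h), rfl⟩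
  rw [← tsum_distinctEven, oddDivisorGF, h₀.tsum_mul_tsum xNull_oddDivisor, ← tsum_congr hfφ,
    hφ.tsum_eq hsupp, hf.tsum_prod]
  refine tsum_congr fun π => ?_
  have hπ := hf.slice π
  rw [hπ.tsum_prod, hπ.tsum_comm]
  have hk : ∀ k, ∑' j, f (π, j, k) = (π.1.parts.count (2 * k + 1) : ℚ⟦X⟧) * X ^ π.1.size := by
    intro k
    rw [tsum_eq_sum (s := Finset.range (π.1.parts.count (2 * k + 1))),
      Finset.sum_congr rfl fun j hj => if_pos (Finset.mem_range.1 hj)]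
    · simp
    · intro j hj
      exact if_neg (by simpa using hj)
  rw [tsum_congr hk, ((hasSum_count_odd π.1.parts).mul_right _).tsum_eq, oddTerm, numOddParts]
  simp

end IntPartition

theorem theorem3 :
    (∀ n : ℕ, Summable fun p : IntPartition.distinctLe n × IntPartition.distinctCard n =>
      IntPartition.pairTerm p.1 p.2) ∧
    (Summable fun n : ℕ =>
      ∑' p : IntPartition.distinctLe n × IntPartition.distinctCard n,
        IntPartition.pairTerm p.1 p.2) ∧
    (Summable fun π : IntPartition.distinctEven => IntPartition.oddTerm π) ∧
    ∑' n : ℕ, ∑' p : IntPartition.distinctLe n × IntPartition.distinctCard n,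
        IntPartition.pairTerm p.1 p.2 =
      2 * ∑' π : IntPartition.distinctEven, IntPartition.oddTerm π := by
  refine ⟨fun n => (IntPartition.xNull_pairTerm n).summable, IntPartition.hasSum_tsum_pairTerm.summable,
    IntPartition.xNull_oddTerm.summable, ?_⟩
  rw [IntPartition.hasSum_tsum_pairTerm.tsum_eq, IntPartition.tsum_oddTerm,
    ← PowerSeries.tsum_gammaGF_eq_distinctEvenGF]
  exact PowerSeries.tsum_weight_mul_gammaGF
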